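/- Let $p_1, p_2$ be two distinct places of $\mathbb{Q}$, each being either a prime number or $\infty$. For a prime $p$ let $\mathbb{Z}_p$ be the ring of $p$-adic integers with the metric of the $p$-adic absolute value $|\cdot|_p$, and put $\mathbb{Z}_\infty = \mathbb{R}/\mathbb{Z}$ with its quotient metric; let $\mu_{p_2}$ be the Haar probability measure on $\mathbb{Z}_{p_2}$. Fix a ball $B \subseteq \mathbb{Z}_{p_1}$ of positive radius. A rational number $r$ is said to lie in $B$ if $r$, viewed in $\mathbb{Q}_{p_1}$, is an element of $B$ (when $p_1$ is a prime), respectively if the coset $r + \mathbb{Z}$ is an element of $B$ (when $p_1 = \infty$). Let $\psi : \mathbb{R}_{>0} \to \mathbb{R}_{>0}$ be monotonically decreasing (not necessarily strictly), and suppose that for every real $s > 1$ there exists $c > 0$ such that $\psi(sn) > c\,\psi(n)$ for all sufficiently large $n \in \mathbb{N}$. Let $$W = \left\{ \alpha \in \mathbb{Z}_{p_2} : \left|\alpha - \tfrac{a}{n}\right|_{p_2} < \psi(\max(|a|, n)) \text{ for infinitely many rationals } \tfrac{a}{n} \in B \ (a \in \mathbb{Z},\ n \in \mathbb{N},\ n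 \ge 1) \right\},$$ where, if $p_2 = \infty$, $|\cdot|_\infty$ is the usual absolute value on $\mathbb{R}$ and $\alpha \in \mathbb{R}/\mathbb{Z}$ is replaced by its representative in $[0,1)$. Then $$\mu_{p_2}(W) = \begin{cases} 1 & \text{if } \sum_{n=1}^\infty n\,\psi(n) = \infty, \\ 0 & \text{if } \sum_{n=1}^\infty n\,\psi(n) < \infty. \end{cases}$$ -/

import Mathlib

open MeasureTheory

noncomputable section

/-- A place of `ℚ`: the archimedean place or a prime number. -/
inductive Place : Type
  | infinite : Place
  | finite (p : Nat.Primes) : Place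

namespace Place

instance primeFact (p : Nat.Primes) : Fact (p : ℕ).Prime := ⟨p.2⟩

/-- The compact group `ℤ_v`: the circle `ℝ / ℤ` if `v = ∞`, the `p`-adic integers if `v = p`. -/
def Integers : Place → Type
  | infinite => UnitAddCircle
  | finite p => ℤ_[(p : ℕ)]

/-- `ℝ / ℤ` carries the quotient metric and `ℤ_p` the metric of the `p`-adic norm. -/
instance instNormedAddCommGroup : (v : Place) → NormedAddCommGroup v.Integers
  | infinite => inferInstanceAs (NormedAddCommGroup UnitAddCircle)
  | finite p => inferInstanceAs (NormedAddCommGroup ℤ_[(p : ℕ)])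

instance instCompactSpace : (v : Place) → CompactSpace v.Integers
  | infinite => inferInstanceAs (CompactSpace UnitAddCircle)
  | finite p => inferInstanceAs (CompactSpace ℤ_[(p : ℕ)])

/-- The Borel σ-algebra of `ℤ_v`. -/
instance instMeasurableSpace : (v : Place) → MeasurableSpace v.Integers
  | infinite => inferInstanceAs (MeasurableSpace UnitAddCircle)
  | finite p => borel ℤ_[(p : ℕ)]

instance instBorelSpace : (v : Place) → BorelSpace v.Integers
  | infinite => inferInstanceAs (BorelSpace UnitAddCircle)
  | finite _ => ⟨rfl⟩

/-- The Haar probability measure on `ℤ_v`. -/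
def haar (v : Place) : Measure v.Integers := Measure.addHaarMeasure ⊤

/-- The rational `r` lies in the subset `B` of `ℤ_v`: for `v = ∞` this means that the coset
`r + ℤ` belongs to `B`, for `v = p` that `r`, as a `p`-adic number, is an element of `B`. -/
def RatMem : (v : Place) → ℚ → Set v.Integers → Prop
  | infinite => fun r (B : Set UnitAddCircle) => ((r : ℝ) : UnitAddCircle) ∈ B
  | finite p => fun r (B : Set ℤ_[(p : ℕ)]) => ∃ x ∈ B, (x : ℚ_[(p : ℕ)]) = (r : ℚ_[(p : ℕ)])

/-- The distance `|α - r|_v` for `α ∈ ℤ_v` and `r ∈ ℚ`. For `v = ∞` the coset `α` stands for its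
representative in `[0, 1)`, and the distance is the usual one in `ℝ`. -/
def absSub : (v : Place) → v.Integers → ℚ → ℝ
  | infinite => fun (α : UnitAddCircle) r => |(AddCircle.equivIco (1 : ℝ) 0 α : ℝ) - (r : ℝ)|
  | finite p => fun (α : ℤ_[(p : ℕ)]) r => ‖(α : ℚ_[(p : ℕ)]) - (r : ℚ_[(p : ℕ)])‖

/-- A ball of positive radius in `ℤ_v`, open or closed. -/
def IsBall (v : Place) (B : Set v.Integers) : Prop :=
  ∃ (x : v.Integers) (ρ : ℝ), 0 < ρ ∧ (B = Metric.ball x ρ ∨ B = Metric.closedBall x ρ)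

/-- The `α ∈ ℤ_w` for which there are infinitely many rational numbers `r` in `B ⊆ ℤ_v` that can
be written as a fraction `r = a / n` with `|α - a / n|_w < ψ (max (|a|, n))`. -/
def approximables (v w : Place) (ψ : ℝ → ℝ) (B : Set v.Integers) : Set w.Integers :=
  {α | {r : ℚ | v.RatMem r B ∧ ∃ (a : ℤ) (n : ℕ), 0 < n ∧ r = (a : ℚ) / (n : ℚ) ∧
    w.absSub α r < ψ (max |(a : ℝ)| (n : ℝ))}.Infinite}

end Place

end

/-! ### Ubiquity in spaces where a ball has measure comparable to its radius. -/

section Ubiquity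

open Metric Set Filter Topology

/-! The Haar measure of a ball of radius `ρ ≤ 1` in `ℤ_w` is of order `ρ` (`IsOneRegular`), for `ℝ /
ℤ` and for `ℤ_p` alike; most of the measure theory rests on this alone and so treats all places
together.

Convergence is Borel–Cantelli over pairs `(a, n)`: the points within `ψ m` of `a / n`, where `m =
max (|a|, n)`, have measure `O(ψ m)`, and `O(m)` pairs share the same `m`.

For divergence it is enough to use fractions in `B` with `0 ≤ a < n`, `2 ^ k / 2 < n ≤ 2 ^ k` and
`gcd (a, n) ≤ D`. They are ubiquitous in `ℤ_w` for two reasons. They are `4 ^ (-k)`-separated,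
because a nonzero integer `a m - b n` has real absolute value at least `1`, and `p`-adic absolute
value at least the inverse of its size (`inv_sq_le_dist_ofRat`). They also fill every ball: the
Chinese remainder theorem, together with an interval condition at the infinite place, gives at least
a constant times `ρ N ^ 2` pairs with `n ≤ N = 2 ^ k` that lie in `B` and in a given ball of radius
`ρ`. Separation after cancelling `d` shows that only `O(ρ N ^ 2 / d ^ 2 + 1)` of these have gcd `d`,
so for large `D` at least half have gcd at most `D`, and each fraction then arises from at most `D`
pairs (`exists_card_fractions_ge`).

Separation also bounds the overlaps of neighbourhoods at different levels. By the Chung–Erdős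
inequality the limsup set then has a fixed proportion of the measure of every small ball, and
Lebesgue's density theorem makes it full (`IsOneRegular.ae_frequently_mem_closedBall`). The
divergence needed, that of `∑ 4 ^ k ψ(2 ^ k)`, follows by condensation. -/

/-- The measure of a ball is comparable to its radius. -/
structure IsOneRegular {X : Type*} [PseudoMetricSpace X] [MeasurableSpace X] (μ : Measure X)
    (c₁ c₂ : ℝ) : Prop where
  pos : 0 < c₁
  lower : ∀ (x : X) (ρ : ℝ), 0 < ρ → ρ ≤ 1 → c₁ * ρ ≤ μ.real (closedBall x ρ)
  upper : ∀ (x : X) (ρ : ℝ), 0 < ρ → μ.real (closedBall x ρ) ≤ c₂ * ρ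

/-- The **Chung–Erdős inequality**. -/
theorem sq_sum_measureReal_le {X ι : Type*} [MeasurableSpace X] (μ : Measure X)
    [IsFiniteMeasure μ] (S : Finset ι) (E : ι → Set X) (hE : ∀ i, MeasurableSet (E i)) :
    (∑ i ∈ S, μ.real (E i)) ^ 2 ≤
      μ.real (⋃ i ∈ S, E i) * ∑ i ∈ S, ∑ j ∈ S, μ.real (E i ∩ E j) := by
  classical
  set U : Set X := ⋃ i ∈ S, E i with hU
  have hUm : MeasurableSet U := S.measurableSet_biUnion fun i _ => hE i
  set T := ∑ i ∈ S, μ.real (E i) with hT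
  set Q := ∑ i ∈ S, ∑ j ∈ S, μ.real (E i ∩ E j) with hQ
  have one (s : Set X) (hs : MeasurableSet s) : Integrable (s.indicator (1 : X → ℝ)) μ :=
    (integrable_const (1 : ℝ)).indicator hs
  -- This is the integral of the square of `∑ 1_{E i} - t 1_U`, since the sum vanishes off `U`. A
  -- quadratic in `t` that is never negative has discriminant at most `0`, which is the claim.
  have key (t : ℝ) : 0 ≤ Q - 2 * t * T + t ^ 2 * μ.real U := by
    have h : ∫ x, ((∑ i ∈ S, ∑ j ∈ S, (E i ∩ E j).indicator (1 : X → ℝ) x)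
        - 2 * t * (∑ i ∈ S, (E i).indicator (1 : X → ℝ) x)
        + t ^ 2 * U.indicator (1 : X → ℝ) x) ∂μ = Q - 2 * t * T + t ^ 2 * μ.real U := by
      have i1 : Integrable (fun x => ∑ i ∈ S, ∑ j ∈ S, (E i ∩ E j).indicator (1 : X → ℝ) x) μ :=
        integrable_finsetSum _ fun i _ => integrable_finsetSum _ fun j _ =>
          one _ ((hE i).inter (hE j))
      have i2 : Integrable (fun x => 2 * t * (∑ i ∈ S, (E i).indicator (1 : X → ℝ) x)) μ :=
        (integrable_finsetSum _ fun i _ => one _ (hE i)).const_mul _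
      have i12 : Integrable (fun x => (∑ i ∈ S, ∑ j ∈ S, (E i ∩ E j).indicator (1 : X → ℝ) x)
          - 2 * t * (∑ i ∈ S, (E i).indicator (1 : X → ℝ) x)) μ := i1.sub i2
      rw [integral_add i12 ((one U hUm).const_mul _), integral_sub i1 i2,
        integral_const_mul, integral_const_mul, integral_indicator_one hUm,
        integral_finsetSum _ fun i _ => one _ (hE i),
        integral_finsetSum _ fun i _ => integrable_finsetSum _ fun j _ =>
          one _ ((hE i).inter (hE j))]
      simp_rw [integral_finsetSum _ fun j _ => one _ ((hE _).inter (hE j)),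
        integral_indicator_one (hE _), integral_indicator_one ((hE _).inter (hE _))]
      rfl
    rw [← h]
    refine integral_nonneg fun x => ?_
    have hsq : (∑ i ∈ S, ∑ j ∈ S, (E i ∩ E j).indicator (1 : X → ℝ) x)
        = (∑ i ∈ S, (E i).indicator (1 : X → ℝ) x) ^ 2 := by
      rw [sq, Finset.sum_mul_sum]
      refine Finset.sum_congr rfl fun i _ => Finset.sum_congr rfl fun j _ => ?_
      rw [inter_indicator_one]; rfl
    simp only [Pi.zero_apply]
    rw [hsq]
    by_cases hx : x ∈ U
    · rw [indicator_of_mem hx, Pi.one_apply]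
      nlinarith [sq_nonneg ((∑ i ∈ S, (E i).indicator (1 : X → ℝ) x) - t)]
    · rw [indicator_of_notMem hx, Finset.sum_eq_zero]
      · simp
      · intro i hi
        exact indicator_of_notMem (fun h => hx (mem_biUnion (Finset.mem_coe.2 hi) h)) _
  have h0 : discrim (μ.real U) (-(2 * T)) Q ≤ 0 :=
    discrim_le_zero fun t => by nlinarith [key t]
  rw [discrim] at h0
  nlinarith

/-- If unions of finitely many arbitrarily late members of a sequence of sets have measure at
least `c`, then so has the upper limit of the sequence. -/
theorem le_measureReal_iInter_iUnion {X : Type*} [MeasurableSpace X] (μ : Measure X)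
    [IsFiniteMeasure μ] (E : ℕ → Set X) (hE : ∀ k, MeasurableSet (E k)) (c : ℝ)
    (h : ∀ m, ∃ M, c ≤ μ.real (⋃ k ∈ Finset.Ico m M, E k)) :
    c ≤ μ.real (⋂ m, ⋃ k, ⋃ (_ : m ≤ k), E k) := by
  have hanti : Antitone fun m => ⋃ k, ⋃ (_ : m ≤ k), E k := fun a b hab =>
    iUnion_mono fun k => iUnion_mono' fun hk => ⟨hab.trans hk, le_rfl⟩
  have ht : Tendsto (fun m => μ.real (⋃ k, ⋃ (_ : m ≤ k), E k)) atTop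
      (𝓝 (μ.real (⋂ m, ⋃ k, ⋃ (_ : m ≤ k), E k))) := by
    refine (ENNReal.tendsto_toReal (measure_ne_top _ _)).comp
      (tendsto_measure_iInter_atTop (fun m => ?_) hanti ⟨0, measure_ne_top _ _⟩)
    exact (MeasurableSet.iUnion fun k => MeasurableSet.iUnion fun _ => hE k).nullMeasurableSet
  refine ge_of_tendsto' ht fun m => ?_
  obtain ⟨M, hM⟩ := h m
  refine hM.trans (measureReal_mono ?_ (measure_ne_top _ _))
  refine iUnion_mono fun k => iUnion_mono' fun hk => ⟨(Finset.mem_Ico.1 hk).1, le_rfl⟩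

variable {X I : Type*} [MetricSpace X] [MeasurableSpace X] [BorelSpace X] {μ : Measure X}
  [IsFiniteMeasure μ] {c₁ c₂ : ℝ}

/-- A separated set in a ball has few points. -/
theorem IsOneRegular.card_le (hμ : IsOneRegular μ c₁ c₂) (G : Finset I) (pt : I → X) {δ ρ : ℝ}
    (hδ : 0 < δ) (hδ1 : δ ≤ 1) (hρ : 0 ≤ ρ) (x : X)
    (hsep : ∀ i ∈ G, ∀ j ∈ G, i ≠ j → δ ≤ dist (pt i) (pt j))
    (hx : ∀ i ∈ G, dist (pt i) x ≤ ρ) : (G.card : ℝ) * (c₁ * δ) ≤ 3 * c₂ * (ρ + δ) := by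
  -- Closed balls of radius `δ / 2` could touch; radius `δ / 3` makes them disjoint.
  have hdis : (G : Set I).PairwiseDisjoint fun i => closedBall (pt i) (δ / 3) := by
    intro i hi j hj hij
    refine closedBall_disjoint_closedBall ?_
    linarith [hsep i hi j hj hij]
  have h1 : μ.real (⋃ i ∈ G, closedBall (pt i) (δ / 3)) =
      ∑ i ∈ G, μ.real (closedBall (pt i) (δ / 3)) :=
    measureReal_biUnion_finset hdis fun _ _ => measurableSet_closedBall
  have h2 : (G.card : ℝ) * (c₁ * (δ / 3)) ≤ ∑ i ∈ G, μ.real (closedBall (pt i) (δ / 3)) := by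
    rw [← nsmul_eq_mul]
    exact Finset.card_nsmul_le_sum _ _ _ fun i _ => hμ.lower _ _ (by positivity) (by linarith)
  have h3 : μ.real (⋃ i ∈ G, closedBall (pt i) (δ / 3)) ≤ μ.real (closedBall x (ρ + δ)) := by
    refine measureReal_mono (iUnion₂_subset fun i hi => ?_)
    exact closedBall_subset_closedBall' (by linarith [hx i hi])
  have h4 := hμ.upper x (ρ + δ) (by positivity)
  nlinarith

theorem IsOneRegular.upper_pos {X : Type*} [PseudoMetricSpace X] [MeasurableSpace X]
    {μ : Measure X} {c₁ c₂ : ℝ} [Nonempty X] (hμ : IsOneRegular μ c₁ c₂) : 0 < c₂ := by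
  have x : X := Classical.arbitrary X
  have := hμ.lower x 1 one_pos le_rfl
  have := hμ.upper x 1 one_pos
  linarith [hμ.pos]

theorem sum_ite_le_four_pow (S : Finset ℕ) (k : ℕ) :
    ∑ j ∈ S, (if j ≤ k then (4 : ℝ) ^ j else 0) ≤ 2 * 4 ^ k := by
  have h1 : ∑ j ∈ S, (if j ≤ k then (4 : ℝ) ^ j else 0) ≤ ∑ j ∈ Finset.range (k + 1), 4 ^ j := by
    rw [← Finset.sum_filter]
    refine Finset.sum_le_sum_of_subset_of_nonneg (fun j hj => ?_) fun _ _ _ => by positivity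
    simp only [Finset.mem_filter, Finset.mem_range] at hj ⊢
    lia
  refine h1.trans ?_
  rw [geom_sum_eq (by norm_num), pow_succ]
  have : (0 : ℝ) < 4 ^ k := by positivity
  linarith

/-- Quasi-independence on average inside a ball. -/
theorem IsOneRegular.le_measureReal_limsup_of_mem_ball [Nonempty X] (hμ : IsOneRegular μ c₁ c₂)
    (G : ℕ → Finset I) (pt : I → X) (r : ℕ → ℝ) {κ ρ : ℝ} (hκ : 0 < κ) (hρ : 0 < ρ) (x : X)
    (k₀ : ℕ) (hk₀ : ∀ k, k₀ ≤ k → ((4 : ℝ) ^ k)⁻¹ ≤ ρ)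
    (hsep : ∀ k, ∀ i ∈ G k, ∀ j ∈ G k, i ≠ j → ((4 : ℝ) ^ k)⁻¹ ≤ dist (pt i) (pt j))
    (hx : ∀ k, ∀ i ∈ G k, dist (pt i) x ≤ ρ)
    (hcard : ∀ k, k₀ ≤ k → κ * 4 ^ k * ρ ≤ (G k).card)
    (hr : ∀ k, 0 < r k) (hr4 : ∀ k, 4 ^ k * r k ≤ 1 / 4)
    (hdiv : ¬ Summable fun k => 4 ^ k * r k) :
    κ ^ 2 * c₁ ^ 2 / (5 * ((6 * c₂ / c₁) ^ 2 * c₂ + 6 * c₂ / c₁ * c₂)) * ρ ≤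
      μ.real (⋂ m, ⋃ k, ⋃ (_ : m ≤ k), ⋃ i ∈ G k, closedBall (pt i) (r k)) := by
  classical
  have hc₁ := hμ.pos
  have hc₂ := hμ.upper_pos
  set K := 6 * c₂ / c₁ with hK
  have hKpos : 0 < K := by positivity
  set L := K ^ 2 * c₂ + K * c₂ with hL
  have hLpos : 0 < L := by positivity
  set E : ℕ → Set X := fun k => ⋃ i ∈ G k, closedBall (pt i) (r k) with hEdef
  have hE (k : ℕ) : MeasurableSet (E k) :=
    (G k).measurableSet_biUnion fun _ _ => measurableSet_closedBall
  set t : ℕ → ℝ := fun k => 4 ^ k * r k with ht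
  have ht0 (k) : 0 ≤ t k := by have := hr k; positivity
  have h4 (k : ℕ) : (0 : ℝ) < 4 ^ k := by positivity
  have h4i (k : ℕ) : ((4 : ℝ) ^ k)⁻¹ ≤ 1 := inv_le_one_of_one_le₀ (one_le_pow₀ (by norm_num))
  have hri (k : ℕ) : r k ≤ ((4 : ℝ) ^ k)⁻¹ / 4 := by
    rw [inv_eq_one_div, div_div, le_div_iff₀ (by positivity)]
    nlinarith [hr4 k]
  -- the measure of a single set
  have hlow (k : ℕ) (hk : k₀ ≤ k) : κ * c₁ * ρ * t k ≤ μ.real (E k) := by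
    have hdis : (G k : Set I).PairwiseDisjoint fun i => closedBall (pt i) (r k) := by
      intro i hi j hj hij
      refine closedBall_disjoint_closedBall ?_
      have := inv_pos.2 (h4 k)
      linarith [hsep k i hi j hj hij, hri k]
    have h1 : μ.real (E k) = ∑ i ∈ G k, μ.real (closedBall (pt i) (r k)) :=
      measureReal_biUnion_finset hdis fun _ _ => measurableSet_closedBall
    have h2 : ((G k).card : ℝ) * (c₁ * r k) ≤ ∑ i ∈ G k, μ.real (closedBall (pt i) (r k)) := by
      rw [← nsmul_eq_mul]
      exact Finset.card_nsmul_le_sum _ _ _ fun i _ =>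
        hμ.lower _ _ (hr k) (by linarith [hri k, h4i k])
    calc κ * c₁ * ρ * t k = κ * 4 ^ k * ρ * (c₁ * r k) := by rw [ht]; ring
      _ ≤ (G k).card * (c₁ * r k) := by
        have := hr k
        gcongr
        exact hcard k hk
      _ ≤ _ := h2.trans h1.ge
  have hcardup (k : ℕ) (hk : k₀ ≤ k) : ((G k).card : ℝ) ≤ K * ρ * 4 ^ k := by
    have h1 := hμ.card_le (G k) pt (inv_pos.2 (h4 k)) (h4i k) hρ.le x (hsep k) (hx k)
    have h2 : ((G k).card : ℝ) * (c₁ * ((4 : ℝ) ^ k)⁻¹) ≤ 6 * c₂ * ρ := by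
      nlinarith [hk₀ k hk]
    rw [hK]
    field_simp at h2 ⊢
    linarith
  have hup (k : ℕ) (hk : k₀ ≤ k) : μ.real (E k) ≤ K * c₂ * ρ * t k := by
    calc μ.real (E k) ≤ ∑ i ∈ G k, μ.real (closedBall (pt i) (r k)) :=
          measureReal_biUnion_finset_le _ _
      _ ≤ (G k).card * (c₂ * r k) := by
        rw [← nsmul_eq_mul]
        exact Finset.sum_le_card_nsmul _ _ _ fun i _ => hμ.upper _ _ (hr k)
      _ ≤ K * ρ * 4 ^ k * (c₂ * r k) := by
        have := hr k
        gcongr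
        exact hcardup k hk
      _ = _ := by rw [ht]; ring
  -- the measure of an intersection
  have hinter (j k : ℕ) (hj : k₀ ≤ j) : μ.real (E j ∩ E k) ≤
      K ^ 2 * c₂ * ρ * (t j * t k + 4 ^ j * r k) := by
    -- A ball of level `k` meeting this one has its centre within `r j + r k` of `pt i`. Separation
    -- at level `k` leaves only `O(4 ^ k * r j + 1)` such centres.
    have h1 (i : I) : μ.real (closedBall (pt i) (r j) ∩ E k) ≤
        K * (4 ^ k * r j + 1) * (c₂ * r k) := by
      set H := (G k).filter fun i' => dist (pt i') (pt i) ≤ r j + r k with hH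
      have hsub : closedBall (pt i) (r j) ∩ E k ⊆ ⋃ i' ∈ H, closedBall (pt i') (r k) := by
        rintro y ⟨hy1, hy2⟩
        simp only [hEdef, mem_iUnion, mem_closedBall, exists_prop] at hy1 hy2 ⊢
        obtain ⟨i', hi', hy'⟩ := hy2
        refine ⟨i', Finset.mem_filter.2 ⟨hi', ?_⟩, hy'⟩
        linarith [dist_triangle_left (pt i') (pt i) y]
      have hHc : (H.card : ℝ) ≤ K * (4 ^ k * r j + 1) := by
        have h1 := hμ.card_le H pt (inv_pos.2 (h4 k)) (h4i k)
          (add_pos (hr j) (hr k)).le (pt i)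
          (fun a ha b hb => hsep k a (Finset.mem_filter.1 ha).1 b (Finset.mem_filter.1 hb).1)
          (fun a ha => (Finset.mem_filter.1 ha).2)
        have hp := inv_pos.2 (h4 k)
        have h2 : (H.card : ℝ) * (c₁ * ((4 : ℝ) ^ k)⁻¹) ≤
            6 * c₂ * (r j + ((4 : ℝ) ^ k)⁻¹) := by
          have : 3 * c₂ * (r j + r k + ((4 : ℝ) ^ k)⁻¹) ≤
              3 * c₂ * (2 * (r j + ((4 : ℝ) ^ k)⁻¹)) := by
            gcongr
            linarith [hri k, hr j]
          linarith
        rw [hK]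
        field_simp at h2 ⊢
        linarith
      calc μ.real (closedBall (pt i) (r j) ∩ E k)
          ≤ μ.real (⋃ i' ∈ H, closedBall (pt i') (r k)) := measureReal_mono hsub (measure_ne_top _ _)
        _ ≤ ∑ i' ∈ H, μ.real (closedBall (pt i') (r k)) := measureReal_biUnion_finset_le _ _
        _ ≤ H.card * (c₂ * r k) := by
          rw [← nsmul_eq_mul]
          exact Finset.sum_le_card_nsmul _ _ _ fun i _ => hμ.upper _ _ (hr k)
        _ ≤ _ := by
          have := hr k
          gcongr
    calc μ.real (E j ∩ E k) = μ.real (⋃ i ∈ G j, closedBall (pt i) (r j) ∩ E k) := by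
          rw [hEdef]
          simp only [iUnion_inter]
      _ ≤ ∑ i ∈ G j, μ.real (closedBall (pt i) (r j) ∩ E k) := measureReal_biUnion_finset_le _ _
      _ ≤ (G j).card * (K * (4 ^ k * r j + 1) * (c₂ * r k)) := by
        rw [← nsmul_eq_mul]
        exact Finset.sum_le_card_nsmul _ _ _ fun i _ => h1 i
      _ ≤ K * ρ * 4 ^ j * (K * (4 ^ k * r j + 1) * (c₂ * r k)) := by
        have := hr k
        have := hr j
        gcongr
        exact hcardup j hj
      _ = _ := by rw [ht]; ring
  -- The excess over independence. For fixed `k` the sum over `j ≤ k` is geometric, hence at most `2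
  -- * t k`.
  set a : ℕ → ℕ → ℝ := fun j k => if j ≤ k then 4 ^ j * r k else 0 with ha
  have ha0 (j k) : 0 ≤ a j k := by
    rw [ha]; dsimp only
    split_ifs
    · have := hr k; positivity
    · exact le_rfl
  have hpair (j k : ℕ) (hj : k₀ ≤ j) (hk : k₀ ≤ k) :
      μ.real (E j ∩ E k) ≤ L * ρ * (t j * t k + a j k + a k j) := by
    have hKL : K ^ 2 * c₂ ≤ L := by rw [hL]; linarith [mul_pos hKpos hc₂]
    have hKL' : K * c₂ ≤ L := by rw [hL]; linarith [mul_pos (pow_pos hKpos 2) hc₂]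
    have htt := mul_nonneg (ht0 j) (ht0 k)
    rcases lt_trichotomy j k with h | h | h
    · refine (hinter j k hj).trans ?_
      have e : 4 ^ j * r k = a j k := by simp [ha, h.le]
      rw [e]
      have := ha0 j k
      calc _ ≤ L * ρ * (t j * t k + a j k) := by gcongr
        _ ≤ _ := mul_le_mul_of_nonneg_left (by linarith [ha0 k j]) (by positivity)
    · subst h
      rw [inter_self]
      refine (hup j hj).trans ?_
      have e : t j = a j j := by simp [ha, ht]
      have := ha0 j j
      calc K * c₂ * ρ * t j = K * c₂ * ρ * a j j := by rw [← e]
        _ ≤ L * ρ * (t j * t j + a j j + a j j) := by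
          gcongr
          linarith
    · rw [inter_comm]
      refine (hinter k j hk).trans ?_
      have e : 4 ^ k * r j = a k j := by simp [ha, h.le]
      rw [e]
      have := ha0 k j
      rw [mul_comm (t k)]
      calc _ ≤ L * ρ * (t j * t k + a k j) := by gcongr
        _ ≤ _ := mul_le_mul_of_nonneg_left (by linarith [ha0 j k]) (by positivity)
  refine le_measureReal_iInter_iUnion μ E hE _ fun m => ?_
  set m' := max m k₀ with hm'
  -- With total mass `T ≥ 1` the linear term `4 * T` from the excess is absorbed into `5 * T ^ 2`.
  have hM : ∃ M, 1 ≤ ∑ k ∈ Finset.Ico m' M, t k := by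
    have h1 := (not_summable_iff_tendsto_nat_atTop_of_nonneg ht0).1 hdiv
    obtain ⟨M, hM1, hM2⟩ := ((h1.eventually_ge_atTop (1 + ∑ k ∈ Finset.range m', t k)).and
      (eventually_ge_atTop m')).exists
    refine ⟨M, ?_⟩
    have := Finset.sum_range_add_sum_Ico t hM2
    linarith
  obtain ⟨M, hM⟩ := hM
  refine ⟨M, ?_⟩
  have hmono : μ.real (⋃ k ∈ Finset.Ico m' M, E k) ≤ μ.real (⋃ k ∈ Finset.Ico m M, E k) := by
    refine measureReal_mono (biUnion_subset_biUnion_left fun k hk => ?_) (measure_ne_top _ _)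
    have hk := Finset.mem_Ico.1 (Finset.mem_coe.1 hk)
    refine Finset.mem_coe.2 (Finset.mem_Ico.2 ?_)
    exact ⟨(le_max_left _ _).trans hk.1, hk.2⟩
  refine le_trans ?_ hmono
  set S := Finset.Ico m' M with hS
  have hSk (k) (hk : k ∈ S) : k₀ ≤ k := (le_max_right _ _).trans (Finset.mem_Ico.1 hk).1
  set T := ∑ k ∈ S, t k with hT
  have hCE := sq_sum_measureReal_le μ S E hE
  have hA : κ * c₁ * ρ * T ≤ ∑ k ∈ S, μ.real (E k) := by
    rw [hT, Finset.mul_sum]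
    exact Finset.sum_le_sum fun k hk => hlow k (hSk k hk)
  have hasum : ∑ k ∈ S, ∑ j ∈ S, a j k ≤ 2 * T := by
    rw [hT, Finset.mul_sum]
    refine Finset.sum_le_sum fun k _ => ?_
    calc ∑ j ∈ S, a j k = (∑ j ∈ S, if j ≤ k then (4 : ℝ) ^ j else 0) * r k := by
          rw [Finset.sum_mul]
          exact Finset.sum_congr rfl fun j _ => by simp [ha]
      _ ≤ 2 * 4 ^ k * r k := by
          have := hr k
          gcongr
          exact sum_ite_le_four_pow S k
      _ = 2 * t k := by rw [ht]; ring
  have hB : ∑ j ∈ S, ∑ k ∈ S, μ.real (E j ∩ E k) ≤ L * ρ * (5 * T ^ 2) := by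
    calc ∑ j ∈ S, ∑ k ∈ S, μ.real (E j ∩ E k)
        ≤ ∑ j ∈ S, ∑ k ∈ S, L * ρ * (t j * t k + a j k + a k j) :=
          Finset.sum_le_sum fun j hj => Finset.sum_le_sum fun k hk =>
            hpair j k (hSk j hj) (hSk k hk)
      _ = L * ρ * (T * T + ∑ k ∈ S, ∑ j ∈ S, a j k + ∑ k ∈ S, ∑ j ∈ S, a j k) := by
          simp_rw [← Finset.mul_sum, Finset.sum_add_distrib]
          rw [hT, Finset.sum_mul_sum, Finset.sum_comm (f := fun j k => a j k)]
      _ ≤ L * ρ * (5 * T ^ 2) := by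
          gcongr
          nlinarith
  have hTpos : 0 < T := by linarith
  have hU : 0 ≤ μ.real (⋃ k ∈ S, E k) := measureReal_nonneg
  have hfin : (κ * c₁ * ρ * T) ^ 2 ≤ μ.real (⋃ k ∈ S, E k) * (L * ρ * (5 * T ^ 2)) :=
    calc (κ * c₁ * ρ * T) ^ 2 ≤ (∑ k ∈ S, μ.real (E k)) ^ 2 := by gcongr
      _ ≤ _ := hCE
      _ ≤ _ := by gcongr
  have hTρ : 0 < ρ * T ^ 2 := by positivity
  rw [div_mul_eq_mul_div, div_le_iff₀ (by positivity)]
  refine le_of_mul_le_mul_right ?_ hTρ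
  linarith

/-- A ubiquity theorem: if the separated finite sets `F k` fill every ball up to a constant, then
almost every point lies in infinitely many of the `r k`-neighbourhoods of the sets `F k`, as soon
as the measures of these neighbourhoods have a divergent sum. -/
theorem IsOneRegular.ae_frequently_mem_closedBall [SecondCountableTopology X]
    (hμ : IsOneRegular μ c₁ c₂) (F : ℕ → Finset I) (pt : I → X) (r : ℕ → ℝ) {κ : ℝ} (hκ : 0 < κ)
    (hsep : ∀ k, ∀ i ∈ F k, ∀ j ∈ F k, i ≠ j → ((4 : ℝ) ^ k)⁻¹ ≤ dist (pt i) (pt j))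
    (hcard : ∀ (x : X) (ρ : ℝ), 0 < ρ → ρ < 1 / 2 → ∃ k₀, ∀ k, k₀ ≤ k → ∃ G ⊆ F k,
      (∀ i ∈ G, dist (pt i) x ≤ ρ) ∧ κ * 4 ^ k * ρ ≤ G.card)
    (hr : ∀ k, 0 < r k) (hr4 : ∀ k, 4 ^ k * r k ≤ 1 / 4)
    (hdiv : ¬ Summable fun k => 4 ^ k * r k) :
    ∀ᵐ x ∂μ, ∃ᶠ k in atTop, ∃ i ∈ F k, dist x (pt i) ≤ r k := by
  classical
  rcases isEmpty_or_nonempty X with hX | hX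
  · exact ae_of_all _ fun x => (hX.false x).elim
  have hc₁ := hμ.pos
  have hc₂ := hμ.upper_pos
  set c := κ ^ 2 * c₁ ^ 2 / (5 * ((6 * c₂ / c₁) ^ 2 * c₂ + 6 * c₂ / c₁ * c₂)) with hc
  have hcpos : 0 < c := by positivity
  set E : ℕ → Set X := fun k => ⋃ i ∈ F k, closedBall (pt i) (r k) with hEdef
  set W : Set X := ⋂ m, ⋃ k, ⋃ (_ : m ≤ k), E k with hW
  have hWm : MeasurableSet W := MeasurableSet.iInter fun m => MeasurableSet.iUnion fun k =>
    MeasurableSet.iUnion fun _ => (F k).measurableSet_biUnion fun _ _ => measurableSet_closedBall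
  have hr0 : Tendsto (fun k : ℕ => ((4 : ℝ) ^ k)⁻¹) atTop (𝓝 0) := by
    exact tendsto_inv_atTop_zero.comp (tendsto_pow_atTop_atTop_of_one_lt (r := (4 : ℝ))
      (by norm_num))
  -- The constant `c` depends neither on `x` nor on `ρ`. Centres within `ρ` of `x` and radii at most
  -- `ρ` keep the neighbourhoods inside the ball of radius `2 * ρ`.
  have hlocal (x : X) (ρ : ℝ) (hρ : 0 < ρ) (hρ1 : ρ < 1 / 2) :
      c * ρ ≤ μ.real (W ∩ closedBall x (2 * ρ)) := by
    obtain ⟨k₁, hk₁⟩ := hcard x ρ hρ hρ1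
    obtain ⟨k₂, hk₂⟩ := eventually_atTop.1 (hr0.eventually_le_const hρ)
    set k₀ := max k₁ k₂ with hk₀
    refine (hμ.le_measureReal_limsup_of_mem_ball
      (fun k => (F k).filter fun i => dist (pt i) x ≤ ρ) pt r hκ hρ x k₀
      (fun k hk => hk₂ k ((le_max_right _ _).trans hk))
      (fun k i hi j hj => hsep k i (Finset.mem_filter.1 hi).1 j (Finset.mem_filter.1 hj).1)
      (fun k i hi => (Finset.mem_filter.1 hi).2) (fun k hk => ?_) hr hr4 hdiv).trans
      (measureReal_mono ?_)
    · obtain ⟨G, hGF, hGx, hGc⟩ := hk₁ k ((le_max_left _ _).trans hk)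
      refine hGc.trans (Nat.cast_le.2 (Finset.card_le_card fun i hi => ?_))
      exact Finset.mem_filter.2 ⟨hGF hi, hGx i hi⟩
    · intro y hy
      simp only [mem_iInter, mem_iUnion, exists_prop, Finset.mem_filter, mem_closedBall] at hy
      refine ⟨?_, ?_⟩
      · simp only [hW, hEdef, mem_iInter, mem_iUnion, exists_prop, mem_closedBall]
        intro m
        obtain ⟨k, hk, i, hi, hyi⟩ := hy m
        exact ⟨k, hk, i, hi.1, hyi⟩
      · obtain ⟨k, hk, i, hi, hyi⟩ := hy k₂
        have h1 := hk₂ k hk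
        have h2 : r k ≤ ((4 : ℝ) ^ k)⁻¹ := by
          rw [inv_eq_one_div, le_div_iff₀ (by positivity)]
          linarith [hr4 k]
        rw [mem_closedBall]
        linarith [dist_triangle y (pt i) x, hi.2]
  have hdbl : IsUnifLocDoublingMeasure μ := by
    refine ⟨⟨Real.toNNReal (2 * c₂ / c₁), ?_⟩⟩
    have : ∀ᶠ ε : ℝ in 𝓝[>] 0, 0 < ε ∧ ε ≤ 1 :=
      eventually_mem_nhdsWithin.and (eventually_nhdsWithin_of_eventually_nhds
        (eventually_le_nhds zero_lt_one))
    filter_upwards [this] with ε hε x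
    rw [← ENNReal.toReal_le_toReal (measure_ne_top _ _)
      (ENNReal.mul_ne_top ENNReal.coe_ne_top (measure_ne_top _ _)), ENNReal.toReal_mul,
      ENNReal.coe_toReal, Real.coe_toNNReal _ (by positivity)]
    have h1 := hμ.upper x (2 * ε) (by linarith)
    have h2 := hμ.lower x ε hε.1 hε.2
    calc (μ (closedBall x (2 * ε))).toReal ≤ 2 * c₂ / c₁ * (c₁ * ε) := by
          refine h1.trans (le_of_eq ?_)
          field_simp
      _ ≤ _ := by
          refine mul_le_mul_of_nonneg_left h2 (by positivity)
  -- At almost every point of `Wᶜ` the density of `Wᶜ` is `1`, but `hlocal` keeps it at most `1 - c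
  -- / (2 * c₂)` everywhere.
  have hWnull : μ Wᶜ = 0 := by
    have hdens := IsUnifLocDoublingMeasure.ae_tendsto_measure_inter_div μ Wᶜ 1
    have hfalse : ∀ᵐ x ∂μ.restrict Wᶜ, False := by
      filter_upwards [hdens] with x hx
      -- The shift by `3` puts `ρ = 1 / (n + 3)` below `1 / 2` for every `n`, as `hlocal` requires.
      have hδ : Tendsto (fun n : ℕ => 2 * ((n : ℝ) + 3)⁻¹) atTop (𝓝[>] 0) := by
        refine tendsto_nhdsWithin_iff.2 ⟨?_, Eventually.of_forall fun n => ?_⟩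
        · have : Tendsto (fun n : ℕ => (n : ℝ) + 3) atTop atTop :=
            tendsto_atTop_add_const_right _ _ tendsto_natCast_atTop_atTop
          simpa using (tendsto_inv_atTop_zero.comp this).const_mul 2
        · exact mem_Ioi.2 (by positivity)
      have hlim := hx (fun _ : ℕ => x) _ hδ (Eventually.of_forall fun n =>
        mem_closedBall_self (by positivity))
      have hlim' := (ENNReal.tendsto_toReal ENNReal.one_ne_top).comp hlim
      have hle : ∀ n : ℕ, (ENNReal.toReal ∘ fun n : ℕ =>
          μ (Wᶜ ∩ closedBall x (2 * ((n : ℝ) + 3)⁻¹)) / μ (closedBall x (2 * ((n : ℝ) + 3)⁻¹))) n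
          ≤ 1 - c / (2 * c₂) := by
        intro n
        set ρ := ((n : ℝ) + 3)⁻¹ with hρ
        have hρ0 : 0 < ρ := by positivity
        have hρ1 : ρ < 1 / 2 := by
          rw [hρ, inv_eq_one_div]
          refine one_div_lt_one_div_of_lt (by norm_num) ?_
          have : (0 : ℝ) ≤ n := Nat.cast_nonneg n
          linarith
        have h1 := hlocal x ρ hρ0 hρ1
        have h2 := hμ.upper x (2 * ρ) (by positivity)
        have h3 := hμ.lower x (2 * ρ) (by positivity) (by linarith)
        have h4 : 0 < μ.real (closedBall x (2 * ρ)) := lt_of_lt_of_le (by positivity) h3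
        have h5 : μ.real (closedBall x (2 * ρ) ∩ W) + μ.real (closedBall x (2 * ρ) \ W) =
            μ.real (closedBall x (2 * ρ)) := measureReal_inter_add_sdiff hWm
        simp only [Function.comp, ENNReal.toReal_div]
        change μ.real (Wᶜ ∩ closedBall x (2 * ρ)) / μ.real (closedBall x (2 * ρ)) ≤ _
        rw [inter_comm, ← sdiff_eq, div_le_iff₀ h4]
        rw [inter_comm] at h1
        have h6 : c / (2 * c₂) * μ.real (closedBall x (2 * ρ)) ≤ c * ρ := by
          calc _ ≤ c / (2 * c₂) * (c₂ * (2 * ρ)) := by gcongr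
            _ = c * ρ := by field_simp
        linarith
      have := le_of_tendsto' hlim' hle
      have : 0 < c / (2 * c₂) := by positivity
      simp only [ENNReal.toReal_one] at *
      linarith
    rw [ae_iff] at hfalse
    simpa using hfalse
  have : ∀ᵐ x ∂μ, x ∈ W := by rw [ae_iff]; exact hWnull
  filter_upwards [this] with x hx
  rw [frequently_atTop]
  intro m
  simp only [hW, hEdef, mem_iInter, mem_iUnion, exists_prop, mem_closedBall] at hx
  obtain ⟨k, hk, i, hi, h⟩ := hx m
  exact ⟨k, hk, i, hi, h⟩

end Ubiquity

/-! ### Haar measure, fractions and distances at a place. -/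

section Places

open Metric Set

theorem norm_natCast_le_one_padic {p : ℕ} [Fact p.Prime] (a : ℕ) : ‖(a : ℚ_[p])‖ ≤ 1 := by
  exact PadicInt.norm_le_one (a : ℤ_[p])

theorem norm_natCast_eq_one_of_coprime {p : ℕ} [Fact p.Prime] {n : ℕ} (h : n.Coprime p) :
    ‖(n : ℚ_[p])‖ = 1 := by
  exact PadicInt.norm_natCast_eq_one_iff.2 h.symm

theorem norm_natCast_div_le_one {p : ℕ} [Fact p.Prime] (a : ℕ) {n : ℕ} (h : n.Coprime p) :
    ‖(a : ℚ_[p]) / n‖ ≤ 1 := by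
  rw [norm_div, norm_natCast_eq_one_of_coprime h, div_one]
  exact norm_natCast_le_one_padic a

/-- The product formula bounds the `p`-adic norm of an integer from below. -/
theorem inv_abs_le_padic_norm {p : ℕ} [hp : Fact p.Prime] {z : ℤ} (hz : z ≠ 0) :
    (|(z : ℝ)|)⁻¹ ≤ ‖(z : ℚ_[p])‖ := by
  have hz' : (z : ℤ_[p]) ≠ 0 := by exact_mod_cast hz
  have h1 := PadicInt.norm_eq_zpow_neg_valuation hz'
  have h2 : ((p ^ (z : ℤ_[p]).valuation : ℕ) : ℤ) ∣ z := by
    exact_mod_cast PadicInt.norm_int_le_pow_iff_dvd.1 h1.le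
  have h3 : ((p ^ (z : ℤ_[p]).valuation : ℕ) : ℤ) ≤ |z| :=
    Int.le_of_dvd (abs_pos.2 hz) ((dvd_abs _ _).2 h2)
  have h4 : ((p : ℝ) ^ (z : ℤ_[p]).valuation) ≤ |(z : ℝ)| := by exact_mod_cast h3
  have hp0 : (0 : ℝ) < p := by exact_mod_cast hp.out.pos
  have h5 : ‖(z : ℚ_[p])‖ = ‖(z : ℤ_[p])‖ := rfl
  rw [h5, h1, zpow_neg, zpow_natCast]
  exact inv_anti₀ (by positivity) h4

theorem exists_prime_pow_near {p : ℕ} (hp : p.Prime) {ρ : ℝ} (h0 : 0 < ρ) (h1 : ρ ≤ 1) :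
    ∃ e : ℕ, ((p : ℝ) ^ (e + 1))⁻¹ ≤ ρ ∧ ρ ≤ ((p : ℝ) ^ e)⁻¹ := by
  have hp1 : (1 : ℝ) < p := by exact_mod_cast hp.one_lt
  obtain ⟨e, he1, he2⟩ := exists_nat_pow_near_of_lt_one h0 h1
    (inv_pos.2 (zero_lt_one.trans hp1)) (inv_lt_one_of_one_lt₀ hp1)
  exact ⟨e, by rw [← inv_pow]; exact he1.le, by rw [← inv_pow]; exact he2⟩

section PadicMeasure

variable {p : ℕ} [hp : Fact p.Prime] [MeasurableSpace ℤ_[p]] [BorelSpace ℤ_[p]]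
  (μ : Measure ℤ_[p]) [IsProbabilityMeasure μ] [μ.IsAddLeftInvariant]

/-- The balls of this radius around `0, …, p ^ k - 1` partition `ℤ_p` and are translates of each
other. -/
theorem padicInt_measureReal_closedBall (x : ℤ_[p]) (k : ℕ) :
    μ.real (closedBall x ((p : ℝ) ^ k)⁻¹) = ((p : ℝ) ^ k)⁻¹ := by
  have hp0 : (0 : ℝ) < p := by exact_mod_cast hp.out.pos
  have htr (y : ℤ_[p]) : μ.real (closedBall y ((p : ℝ) ^ k)⁻¹) =
      μ.real (closedBall (0 : ℤ_[p]) ((p : ℝ) ^ k)⁻¹) := by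
    have := measure_preimage_add μ y (closedBall y ((p : ℝ) ^ k)⁻¹)
    rw [preimage_add_closedBall, sub_self] at this
    rw [measureReal_def, measureReal_def, this]
  have hz : ((p : ℝ) ^ k)⁻¹ = (p : ℝ) ^ (-k : ℤ) := by rw [zpow_neg, zpow_natCast]
  have hcov : (⋃ i ∈ Finset.range (p ^ k), closedBall ((i : ℕ) : ℤ_[p]) ((p : ℝ) ^ k)⁻¹) =
      univ := by
    refine eq_univ_of_forall fun y => ?_
    simp only [mem_iUnion, Finset.mem_range, exists_prop, mem_closedBall]
    refine ⟨y.appr k, PadicInt.appr_lt y k, ?_⟩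
    rw [dist_eq_norm, hz, PadicInt.norm_le_pow_iff_mem_span_pow]
    exact PadicInt.appr_spec k y
  have hdis : ((Finset.range (p ^ k) : Finset ℕ) : Set ℕ).PairwiseDisjoint
      fun i => closedBall ((i : ℕ) : ℤ_[p]) ((p : ℝ) ^ k)⁻¹ := by
    intro i hi j hj hij
    refine Set.disjoint_left.2 fun y hyi hyj => hij ?_
    have hi := Finset.mem_range.1 (Finset.mem_coe.1 hi)
    have hj := Finset.mem_range.1 (Finset.mem_coe.1 hj)
    rw [mem_closedBall, dist_comm, dist_eq_norm] at hyi
    rw [mem_closedBall, dist_eq_norm] at hyj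
    have h2 : ‖(((i : ℤ) - (j : ℤ) : ℤ) : ℤ_[p])‖ ≤ (p : ℝ) ^ (-k : ℤ) := by
      rw [← hz]
      have e : (((i : ℤ) - (j : ℤ) : ℤ) : ℤ_[p]) = ((i : ℤ_[p]) - y) + (y - (j : ℤ_[p])) := by
        push_cast; ring
      rw [e]
      exact (PadicInt.nonarchimedean _ _).trans (max_le hyi hyj)
    have h3 := PadicInt.norm_int_le_pow_iff_dvd.1 h2
    have h4 : (j : ℤ) ≡ i [ZMOD ((p ^ k : ℕ) : ℤ)] := (Int.modEq_iff_dvd.2 (by exact_mod_cast h3))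
    exact ((Int.natCast_modEq_iff.1 h4).eq_of_lt_of_lt hj hi).symm
  have hsum := measureReal_biUnion_finset (μ := μ) hdis fun _ _ => measurableSet_closedBall
  simp_rw [hcov, probReal_univ, htr (Nat.cast _)] at hsum
  rw [Finset.sum_const, Finset.card_range, nsmul_eq_mul] at hsum
  rw [htr x]
  push_cast at hsum
  exact eq_inv_of_mul_eq_one_right hsum.symm

/-- Rounding the radius down or up to a power of `p` costs a factor of at most `p`; above radius `1`
the total mass suffices. -/
theorem padicInt_isOneRegular : IsOneRegular μ (p : ℝ)⁻¹ p := by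
  have hp0 : (0 : ℝ) < p := by exact_mod_cast hp.out.pos
  have hp1 : (1 : ℝ) < p := by exact_mod_cast hp.out.one_lt
  refine ⟨inv_pos.2 hp0, fun x ρ h0 h1 => ?_, fun x ρ h0 => ?_⟩
  · obtain ⟨e, he1, he2⟩ := exists_prime_pow_near hp.out h0 h1
    calc (p : ℝ)⁻¹ * ρ ≤ (p : ℝ)⁻¹ * ((p : ℝ) ^ e)⁻¹ := by gcongr
      _ = ((p : ℝ) ^ (e + 1))⁻¹ := by rw [pow_succ, mul_inv, mul_comm]
      _ = μ.real (closedBall x ((p : ℝ) ^ (e + 1))⁻¹) :=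
        (padicInt_measureReal_closedBall μ x _).symm
      _ ≤ _ := measureReal_mono (closedBall_subset_closedBall he1)
  · rcases le_or_gt ρ 1 with h1 | h1
    · obtain ⟨e, he1, he2⟩ := exists_prime_pow_near hp.out h0 h1
      calc μ.real (closedBall x ρ) ≤ μ.real (closedBall x ((p : ℝ) ^ e)⁻¹) :=
            measureReal_mono (closedBall_subset_closedBall he2)
        _ = p * ((p : ℝ) ^ (e + 1))⁻¹ := by
            rw [padicInt_measureReal_closedBall, pow_succ]
            field_simp
        _ ≤ _ := by gcongr
    · refine measureReal_le_one.trans ?_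
      nlinarith

end PadicMeasure

theorem unitAddCircle_dist_coe (x y : ℝ) :
    dist (x : UnitAddCircle) (y : UnitAddCircle) = |x - y - round (x - y)| := by
  rw [dist_eq_norm, ← AddCircle.coe_sub, UnitAddCircle.norm_eq]

theorem unitAddCircle_dist_coe_le (x y : ℝ) :
    dist (x : UnitAddCircle) (y : UnitAddCircle) ≤ |x - y| := by
  rw [unitAddCircle_dist_coe]
  simpa using round_le (x - y) 0

open Classical in
/-- The `p`-adic integer given by a rational number, `0` if the rational is not `p`-integral. -/
noncomputable def padicIntOfRat (p : ℕ) [Fact p.Prime] (r : ℚ) : ℤ_[p] :=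
  if h : ∃ x : ℤ_[p], (x : ℚ_[p]) = r then h.choose else 0

theorem coe_padicIntOfRat (p : ℕ) [Fact p.Prime] (a : ℕ) {n : ℕ} (h : n.Coprime p) :
    (padicIntOfRat p ((a : ℚ) / n) : ℚ_[p]) = (a : ℚ_[p]) / n := by
  have h1 : ∃ x : ℤ_[p], (x : ℚ_[p]) = ((a : ℚ) / n : ℚ) :=
    ⟨⟨(a : ℚ_[p]) / n, norm_natCast_div_le_one a h⟩, by push_cast; rfl⟩
  rw [padicIntOfRat, dif_pos h1, h1.choose_spec]
  push_cast
  rfl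

namespace Place

instance instIsProbabilityMeasureHaar (v : Place) : IsProbabilityMeasure v.haar :=
  ⟨by
    rw [haar, ← TopologicalSpace.PositiveCompacts.coe_top]
    exact Measure.addHaarMeasure_self⟩

instance instIsAddLeftInvariantHaar (v : Place) : v.haar.IsAddLeftInvariant := by rw [haar]; infer_instance

theorem exists_isOneRegular_haar (v : Place) : ∃ c₁ c₂, IsOneRegular v.haar c₁ c₂ := by
  cases v with
  | infinite =>
    have hvol : (Measure.addHaarMeasure ⊤ : Measure UnitAddCircle) = volume := by
      change _ = ENNReal.ofReal 1 • Measure.addHaarMeasure ⊤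
      rw [ENNReal.ofReal_one, one_smul]
    have key (x : UnitAddCircle) (ρ : ℝ) (hρ : 0 < ρ) :
        (volume : Measure UnitAddCircle).real (closedBall x ρ) = min 1 (2 * ρ) := by
      rw [measureReal_def, AddCircle.volume_closedBall, ENNReal.toReal_ofReal (by positivity)]
    have : IsOneRegular (Measure.addHaarMeasure ⊤ : Measure UnitAddCircle) 1 2 := by
      rw [hvol]
      refine ⟨one_pos, fun x ρ h0 h1 => ?_, fun x ρ h0 => ?_⟩
      · rw [key x ρ h0]
        exact le_min (by linarith) (by linarith)
      · rw [key x ρ h0]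
        exact min_le_right _ _
    exact ⟨1, 2, this⟩
  | finite p =>
    exact ⟨_, _, @padicInt_isOneRegular p _ (instMeasurableSpace (finite p))
      (instBorelSpace (finite p)) (finite p).haar (instIsProbabilityMeasureHaar (finite p))
      (instIsAddLeftInvariantHaar (finite p))⟩

/-- `p` for the place `p`, and `1` for the archimedean place. -/
def modulus : Place → ℕ
  | infinite => 1
  | finite p => p

/-- The image of a rational number in `ℤ_v`; it is `0` for rationals that are not `v`-integral. -/
noncomputable def ofRat : (v : Place) → ℚ → v.Integers
  | infinite => fun r => ((r : ℝ) : UnitAddCircle)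
  | finite p => padicIntOfRat p

theorem modulus_pos (v : Place) : 0 < v.modulus := by
  cases v with
  | infinite => exact one_pos
  | finite p => exact p.2.pos

theorem coprime_modulus {v w : Place} (h : v ≠ w) : v.modulus.Coprime w.modulus := by
  cases v with
  | infinite => exact Nat.coprime_one_left _
  | finite p =>
    cases w with
    | infinite => exact Nat.coprime_one_right _
    | finite q =>
      refine (Nat.coprime_primes p.2 q.2).2 fun hpq => h ?_
      rw [Subtype.ext hpq]

theorem ratMem_of_ofRat_mem {v : Place} {a n : ℕ} (h : n.Coprime v.modulus) {B : Set v.Integers}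
    (hB : v.ofRat ((a : ℚ) / n) ∈ B) : v.RatMem ((a : ℚ) / n) B := by
  cases v with
  | infinite => exact hB
  | finite p =>
    refine ⟨_, hB, ?_⟩
    refine (coe_padicIntOfRat p a h).trans ?_
    push_cast
    rfl

/-- Distinct fractions of bounded height are far apart in every completion. -/
theorem inv_sq_le_dist_ofRat {v : Place} {a n b m N : ℕ} (han : a < n) (hbm : b < m)
    (hn : n ≤ N) (hm : m ≤ N) (hnv : n.Coprime v.modulus) (hmv : m.Coprime v.modulus)
    (hne : (a : ℚ) / n ≠ (b : ℚ) / m) :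
    ((N : ℝ) ^ 2)⁻¹ ≤ dist (v.ofRat ((a : ℚ) / n)) (v.ofRat ((b : ℚ) / m)) := by
  have hn0 : (0 : ℝ) < n := by exact_mod_cast (Nat.zero_le a).trans_lt han
  have hm0 : (0 : ℝ) < m := by exact_mod_cast (Nat.zero_le b).trans_lt hbm
  have hnN : (n : ℝ) ≤ N := by exact_mod_cast hn
  have hmN : (m : ℝ) ≤ N := by exact_mod_cast hm
  have han' : (a : ℝ) < n := by exact_mod_cast han
  have hbm' : (b : ℝ) < m := by exact_mod_cast hbm
  have ha0 : (0 : ℝ) ≤ a := Nat.cast_nonneg a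
  have hb0 : (0 : ℝ) ≤ b := Nat.cast_nonneg b
  have hneZ : ((a : ℤ) * m - b * n : ℤ) ≠ 0 := by
    intro h
    apply hne
    rw [div_eq_div_iff (by exact_mod_cast hn0.ne') (by exact_mod_cast hm0.ne')]
    have : (a : ℤ) * m = b * n := by linarith
    exact_mod_cast this
  cases v with
  | infinite =>
    change _ ≤ dist ((((a : ℚ) / n : ℚ) : ℝ) : UnitAddCircle) ((((b : ℚ) / m : ℚ) : ℝ) : UnitAddCircle)
    rw [unitAddCircle_dist_coe]
    push_cast
    set s : ℝ := (a : ℝ) / n - b / m with hs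
    set j : ℤ := round s with hj
    have e : s - j = (((a : ℤ) * m - b * n - j * (n * m) : ℤ) : ℝ) / (n * m) := by
      rw [hs]; push_cast; field_simp
    -- Both fractions lie in `[0, 1)`, so if their difference is an integer it is `0`, which `hneZ`
    -- excludes.
    have hz : ((a : ℤ) * m - b * n - j * (n * m) : ℤ) ≠ 0 := by
      intro h
      rw [h, Int.cast_zero, zero_div] at e
      have h1 : (a : ℝ) / n < 1 := (div_lt_one hn0).2 han'
      have h2 : (b : ℝ) / m < 1 := (div_lt_one hm0).2 hbm'
      have h3 : 0 ≤ (a : ℝ) / n := by positivity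
      have h4 : 0 ≤ (b : ℝ) / m := by positivity
      have h5 : (j : ℝ) < 1 := by linarith
      have h6 : (-1 : ℝ) < j := by linarith
      have h5' : j < 1 := by exact_mod_cast h5
      have h6' : -1 < j := by exact_mod_cast h6
      have h7 : j = 0 := by lia
      rw [h7, zero_mul, sub_zero] at h
      exact hneZ h
    rw [e, abs_div, abs_of_pos (mul_pos hn0 hm0), inv_eq_one_div]
    have h1 : (1 : ℝ) ≤ |(((a : ℤ) * m - b * n - j * (n * m) : ℤ) : ℝ)| := by
      exact_mod_cast Int.one_le_abs hz
    refine div_le_div₀ (by positivity) h1 (by positivity) ?_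
    nlinarith
  | finite p =>
    change _ ≤ ‖(padicIntOfRat p ((a : ℚ) / n) : ℚ_[(p : ℕ)]) -
      (padicIntOfRat p ((b : ℚ) / m) : ℚ_[(p : ℕ)])‖
    rw [coe_padicIntOfRat p a hnv, coe_padicIntOfRat p b hmv]
    have hn1 := norm_natCast_eq_one_of_coprime (p := p) hnv
    have hm1 := norm_natCast_eq_one_of_coprime (p := p) hmv
    have hnp : (n : ℚ_[(p : ℕ)]) ≠ 0 := norm_ne_zero_iff.1 (by rw [hn1]; exact one_ne_zero)
    have hmp : (m : ℚ_[(p : ℕ)]) ≠ 0 := norm_ne_zero_iff.1 (by rw [hm1]; exact one_ne_zero)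
    have e : (a : ℚ_[(p : ℕ)]) / n - b / m = (((a : ℤ) * m - b * n : ℤ) : ℚ_[(p : ℕ)]) / (n * m) := by
      push_cast; field_simp
    rw [e, norm_div, norm_mul, hn1, hm1, mul_one, div_one]
    refine le_trans ?_ (inv_abs_le_padic_norm hneZ)
    have hpos : (0 : ℝ) < |(((a : ℤ) * m - b * n : ℤ) : ℝ)| := by
      exact_mod_cast abs_pos.2 hneZ
    refine inv_anti₀ hpos ?_
    push_cast
    rw [abs_le]
    constructor <;> nlinarith

/-- Every small ball contains all fractions satisfying suitable congruences and inequalities. -/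
theorem exists_box_subset_closedBall (v : Place) : ∃ c : ℝ, 0 < c ∧
    ∀ (x : v.Integers) (ρ : ℝ), 0 < ρ → ρ < 1 / 2 → ∃ (z e : ℕ) (β γ : ℝ), 0 ≤ β ∧ β < γ ∧ γ ≤ 1 ∧
      (v.modulus = 1 ∨ β = 0 ∧ γ = 1) ∧ c * ρ ≤ (γ - β) / (v.modulus : ℝ) ^ e ∧
      ∀ a n : ℕ, 0 < n → n ≡ 1 [MOD v.modulus] → a ≡ z * n [MOD v.modulus ^ e] →
        β * n < a → a < γ * n → dist (v.ofRat ((a : ℚ) / n)) x ≤ ρ := by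
  cases v with
  | infinite =>
    refine ⟨1, one_pos, fun (x : UnitAddCircle) ρ h0 h1 => ?_⟩
    set y : ℝ := (AddCircle.equivIco (1 : ℝ) 0 x : ℝ) with hy
    have hy01 := (AddCircle.equivIco (1 : ℝ) 0 x).2
    have hyx : ((y : ℝ) : UnitAddCircle) = x := AddCircle.coe_equivIco
    have hy0 : 0 ≤ y := hy01.1
    have hy1 : y < 1 := by simpa using hy01.2
    have key (β γ : ℝ) (hβ : y - ρ ≤ β) (hγ : γ ≤ y + ρ) (a n : ℕ) (hn : 0 < n)
        (ha1 : β * n < a) (ha2 : a < γ * n) :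
        dist (infinite.ofRat ((a : ℚ) / n)) x ≤ ρ := by
      change dist ((((a : ℚ) / n : ℚ) : ℝ) : UnitAddCircle) x ≤ ρ
      have hn' : (0 : ℝ) < n := by exact_mod_cast hn
      rw [← hyx]
      refine (unitAddCircle_dist_coe_le _ _).trans ?_
      push_cast
      rw [← lt_div_iff₀ hn'] at ha1
      rw [← div_lt_iff₀ hn'] at ha2
      rw [abs_le]
      constructor <;> linarith
    -- Use the half of the ball, right or left of `y`, that does not leave `[0, 1]`.
    rcases le_or_gt y (1 / 2) with hle | hgt
    · refine ⟨0, 0, y, y + ρ, hy0, by linarith, by linarith, Or.inl rfl, by simp, ?_⟩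
      intro a n hn _ _
      exact key _ _ (by linarith) le_rfl a n hn
    · refine ⟨0, 0, y - ρ, y, by linarith, by linarith, by linarith, Or.inl rfl, by simp, ?_⟩
      intro a n hn _ _
      exact key _ _ le_rfl (by linarith) a n hn
  | finite p =>
    have hp0 : (0 : ℝ) < (p : ℕ) := by exact_mod_cast p.2.pos
    refine ⟨((p : ℕ) : ℝ)⁻¹, inv_pos.2 hp0, fun (x : ℤ_[(p : ℕ)]) ρ h0 h1 => ?_⟩
    obtain ⟨e, he1, he2⟩ := exists_prime_pow_near p.2 h0 (by linarith)
    refine ⟨x.appr (e + 1), e + 1, 0, 1, le_rfl, one_pos, le_rfl, Or.inr ⟨rfl, rfl⟩, ?_, ?_⟩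
    · change ((p : ℕ) : ℝ)⁻¹ * ρ ≤ (1 - 0) / ((p : ℕ) : ℝ) ^ (e + 1)
      calc ((p : ℕ) : ℝ)⁻¹ * ρ ≤ ((p : ℕ) : ℝ)⁻¹ * (((p : ℕ) : ℝ) ^ e)⁻¹ := by gcongr
        _ = _ := by rw [pow_succ]; field_simp; ring
    · intro a n _ hn1 han _ _
      change n ≡ 1 [MOD (p : ℕ)] at hn1
      change a ≡ x.appr (e + 1) * n [MOD (p : ℕ) ^ (e + 1)] at han
      set z := x.appr (e + 1) with hz
      have hnv : n.Coprime p := by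
        rw [Nat.Coprime, hn1.gcd_eq, Nat.gcd_one_left]
      change ‖(padicIntOfRat p ((a : ℚ) / n) : ℚ_[(p : ℕ)]) - (x : ℚ_[(p : ℕ)])‖ ≤ ρ
      rw [coe_padicIntOfRat p a hnv]
      have hnorm := norm_natCast_eq_one_of_coprime (p := p) hnv
      have hnp : (n : ℚ_[(p : ℕ)]) ≠ 0 := norm_ne_zero_iff.1 (by rw [hnorm]; exact one_ne_zero)
      have hzz : (((p : ℕ) : ℝ) ^ (e + 1))⁻¹ = ((p : ℕ) : ℝ) ^ (-(e + 1 : ℕ) : ℤ) := by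
        rw [zpow_neg, zpow_natCast]
      have e1 : ‖(a : ℚ_[(p : ℕ)]) / n - z‖ ≤ (((p : ℕ) : ℝ) ^ (e + 1))⁻¹ := by
        have e2 : (a : ℚ_[(p : ℕ)]) / n - z = (((a : ℤ) - (z * n : ℕ) : ℤ) : ℤ_[(p : ℕ)]) / n := by
          push_cast; field_simp
        rw [e2, norm_div, hnorm, div_one, hzz]
        refine PadicInt.norm_int_le_pow_iff_dvd.2 ?_
        exact_mod_cast (Nat.modEq_iff_dvd.1 han.symm)
      have e3 : ‖(z : ℚ_[(p : ℕ)]) - x‖ ≤ (((p : ℕ) : ℝ) ^ (e + 1))⁻¹ := by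
        have h := PadicInt.appr_spec (e + 1) x
        rw [← PadicInt.norm_le_pow_iff_mem_span_pow, ← hzz] at h
        rw [norm_sub_rev]
        exact h
      have e4 : (a : ℚ_[(p : ℕ)]) / n - x = ((a : ℚ_[(p : ℕ)]) / n - z) + (z - x) := by ring
      rw [e4]
      exact ((Padic.nonarchimedean _ _).trans (max_le e1 e3)).trans he1

/-- On the circle the two distances differ only if the short arc passes through `0`, and then it is
longer than the distance from the representative of `α` to `0` or to `1`. At a prime they agree, as
`a / n` is integral. -/
theorem absSub_lt_of_dist_ofRat_lt {v : Place} {α : v.Integers} (hα : α ≠ 0) : ∃ δ₀ : ℝ, 0 < δ₀ ∧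
    ∀ (a n : ℕ) (δ : ℝ), a < n → n.Coprime v.modulus → δ ≤ δ₀ →
      dist α (v.ofRat ((a : ℚ) / n)) < δ → v.absSub α ((a : ℚ) / n) < δ := by
  cases v with
  | infinite =>
    change UnitAddCircle at α
    set y : ℝ := (AddCircle.equivIco (1 : ℝ) 0 α : ℝ) with hy
    have hy01 := (AddCircle.equivIco (1 : ℝ) 0 α).2
    have hyx : ((y : ℝ) : UnitAddCircle) = α := AddCircle.coe_equivIco
    have hy1 : y < 1 := by simpa using hy01.2
    have hy0 : 0 < y := by
      refine lt_of_le_of_ne hy01.1 fun h => hα ?_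
      rw [← hyx, ← h]
      rfl
    refine ⟨min y (1 - y), lt_min hy0 (by linarith), fun a n δ han _ hδ hd => ?_⟩
    have hn0 : (0 : ℝ) < n := by exact_mod_cast (Nat.zero_le a).trans_lt han
    have han' : (a : ℝ) < n := by exact_mod_cast han
    have h1 : (a : ℝ) / n < 1 := (div_lt_one hn0).2 han'
    have h3 : 0 ≤ (a : ℝ) / n := by positivity
    change dist α ((((a : ℚ) / n : ℚ) : ℝ) : UnitAddCircle) < δ at hd
    change |y - (((a : ℚ) / n : ℚ) : ℝ)| < δ
    rw [← hyx, unitAddCircle_dist_coe] at hd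
    push_cast at hd ⊢
    set t := y - (a : ℝ) / n with ht
    have hr := abs_le.1 (abs_sub_round t)
    have hδ1 := hδ.trans (min_le_left _ _)
    have hδ2 := hδ.trans (min_le_right _ _)
    have hj1 : round t < 2 := by
      have : (round t : ℝ) < 2 := by linarith [hr.1]
      exact_mod_cast this
    have hj2 : -2 < round t := by
      have : (-2 : ℝ) < round t := by linarith [hr.2]
      exact_mod_cast this
    have hd' := abs_lt.1 hd
    have hj : round t = -1 ∨ round t = 0 ∨ round t = 1 := by lia
    rcases hj with h | h | h
    · rw [h] at hd'
      push_cast at hd'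
      linarith [hd'.2]
    · rw [h] at hd
      simpa using hd
    · rw [h] at hd'
      push_cast at hd'
      linarith [hd'.1]
  | finite p =>
    change ℤ_[(p : ℕ)] at α
    refine ⟨1, one_pos, fun a n δ _ hn _ hd => ?_⟩
    change ‖(α : ℚ_[(p : ℕ)]) - (padicIntOfRat p ((a : ℚ) / n) : ℚ_[(p : ℕ)])‖ < δ at hd
    rw [coe_padicIntOfRat p a hn] at hd
    change ‖(α : ℚ_[(p : ℕ)]) - (((a : ℚ) / n : ℚ) : ℚ_[(p : ℕ)])‖ < δ
    push_cast
    exact hd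

/-- Valid also when `r` has no image in `ℤ_v`, as the convergence case requires. -/
theorem dist_le_absSub_add_absSub {v : Place} (α β : v.Integers) (r : ℚ) :
    dist α β ≤ v.absSub α r + v.absSub β r := by
  cases v with
  | infinite =>
    change UnitAddCircle at α
    change UnitAddCircle at β
    have hα : (((AddCircle.equivIco (1 : ℝ) 0 α : ℝ)) : UnitAddCircle) = α := AddCircle.coe_equivIco
    have hβ : (((AddCircle.equivIco (1 : ℝ) 0 β : ℝ)) : UnitAddCircle) = β := AddCircle.coe_equivIco
    change dist α β ≤ |(AddCircle.equivIco (1 : ℝ) 0 α : ℝ) - (r : ℝ)| +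
      |(AddCircle.equivIco (1 : ℝ) 0 β : ℝ) - (r : ℝ)|
    calc dist α β = dist (((AddCircle.equivIco (1 : ℝ) 0 α : ℝ)) : UnitAddCircle)
          (((AddCircle.equivIco (1 : ℝ) 0 β : ℝ)) : UnitAddCircle) := by rw [hα, hβ]
      _ ≤ _ := unitAddCircle_dist_coe_le _ _
      _ ≤ _ := by
        rw [abs_sub_comm (AddCircle.equivIco (1 : ℝ) 0 β : ℝ)]
        exact abs_sub_le _ _ _
  | finite p =>
    change ℤ_[(p : ℕ)] at α
    change ℤ_[(p : ℕ)] at β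
    change ‖(α : ℚ_[(p : ℕ)]) - (β : ℚ_[(p : ℕ)])‖ ≤
      ‖(α : ℚ_[(p : ℕ)]) - (r : ℚ_[(p : ℕ)])‖ + ‖(β : ℚ_[(p : ℕ)]) - (r : ℚ_[(p : ℕ)])‖
    rw [norm_sub_rev (β : ℚ_[(p : ℕ)])]
    exact norm_sub_le_norm_sub_add_norm_sub _ _ _

end Place

end Places

/-! ### Counting pairs and fractions in balls. -/

section Counting

/-- An interval of real numbers contains many members of a residue class. -/
theorem exists_finset_modEq (M : ℕ) (hM : 0 < M) (s : ℕ) {A B : ℝ} (hA : 0 ≤ A) :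
    ∃ G : Finset ℕ, (∀ a ∈ G, A < a ∧ (a : ℝ) < B ∧ a ≡ s [MOD M]) ∧
      (B - A) / M - 1 ≤ G.card := by
  have hM' : (0 : ℝ) < M := by exact_mod_cast hM
  have hs : ((s % M : ℕ) : ℝ) < M := by exact_mod_cast Nat.mod_lt s hM
  set u : ℝ := (A - (s % M : ℕ)) / M with hu
  set t : ℝ := (B - (s % M : ℕ)) / M with ht
  have hu1 : -1 < u := by
    rw [hu, lt_div_iff₀ hM']
    linarith
  have hinj : Function.Injective fun j : ℕ => s % M + M * j := fun i j h => by
    have : M * i = M * j := by simpa using h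
    exact Nat.eq_of_mul_eq_mul_left hM this
  -- The indices are the naturals strictly between `u` and `t`; since `u > -1`, the floor of `u + 1`
  -- loses nothing to truncation at `0`.
  refine ⟨(Finset.Ico ⌊u + 1⌋₊ ⌈t⌉₊).image fun j => s % M + M * j, ?_, ?_⟩
  · intro a ha
    obtain ⟨j, hj, rfl⟩ := Finset.mem_image.1 ha
    obtain ⟨hj1, hj2⟩ := Finset.mem_Ico.1 hj
    have h1 : u < j := by
      have h2 := Nat.lt_floor_add_one (u + 1)
      have h3 : ((⌊u + 1⌋₊ : ℕ) : ℝ) ≤ j := by exact_mod_cast hj1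
      linarith
    have h2 : (j : ℝ) < t := Nat.lt_ceil.1 hj2
    rw [hu, div_lt_iff₀ hM'] at h1
    rw [ht, lt_div_iff₀ hM'] at h2
    push_cast at h1 h2 ⊢
    refine ⟨by linarith, by linarith, ?_⟩
    rw [Nat.ModEq, Nat.add_mul_mod_self_left, Nat.mod_mod]
  · rw [Finset.card_image_of_injective _ hinj, Nat.card_Ico]
    have h1 : ((⌊u + 1⌋₊ : ℕ) : ℝ) ≤ u + 1 := Nat.floor_le (by linarith)
    have h2 : t ≤ (⌈t⌉₊ : ℕ) := Nat.le_ceil t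
    have h3 : ((⌈t⌉₊ : ℕ) : ℝ) ≤ ((⌈t⌉₊ - ⌊u + 1⌋₊ : ℕ) : ℝ) + (⌊u + 1⌋₊ : ℕ) := by
      exact_mod_cast le_tsub_add
    have h4 : (B - A) / M = t - u := by rw [ht, hu]; ring
    linarith

/-- The number of pairs `(a, n)` with `N / 2 < n ≤ N`, with `n` and `a` in prescribed residue classes
and with `a / n` in a prescribed interval, is at least of order `N ^ 2`. -/
theorem exists_finset_pairs (M M' : ℕ) (hM : 0 < M) (hM' : 0 < M') (z : ℕ) {β γ : ℝ}
    (hβ : 0 ≤ β) (hβγ : β < γ) : ∃ N₀ : ℕ, ∀ N : ℕ, N₀ ≤ N → ∃ P : Finset (ℕ × ℕ),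
      (∀ x ∈ P, N < 2 * x.2 ∧ x.2 ≤ N ∧ x.2 ≡ 1 [MOD M'] ∧ x.1 ≡ z * x.2 [MOD M] ∧
        β * x.2 < x.1 ∧ x.1 < γ * x.2) ∧
      (γ - β) / M / (16 * M') * (N : ℝ) ^ 2 ≤ P.card := by
  classical
  have hMr : (0 : ℝ) < M := by exact_mod_cast hM
  have hMr' : (0 : ℝ) < M' := by exact_mod_cast hM'
  have hd : 0 < γ - β := by linarith
  -- From here on, the loss of `1` in each count of `exists_finset_modEq` is at most half of the
  -- main term.
  refine ⟨⌈4 * (M' : ℝ)⌉₊ + ⌈4 * M / (γ - β)⌉₊, fun N hN => ?_⟩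
  have hN' : ((⌈4 * (M' : ℝ)⌉₊ : ℕ) : ℝ) + (⌈4 * M / (γ - β)⌉₊ : ℕ) ≤ N := by exact_mod_cast hN
  have hN1 : 4 * (M' : ℝ) ≤ N := by
    have := Nat.le_ceil (4 * (M' : ℝ))
    have : (0 : ℝ) ≤ (⌈4 * M / (γ - β)⌉₊ : ℕ) := Nat.cast_nonneg _
    linarith
  have hN2 : 4 * M ≤ (γ - β) * N := by
    have h1 := Nat.le_ceil (4 * M / (γ - β))
    have h2 : (0 : ℝ) ≤ (⌈4 * (M' : ℝ)⌉₊ : ℕ) := Nat.cast_nonneg _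
    have h3 : 4 * M / (γ - β) ≤ N := by linarith
    rw [div_le_iff₀ hd] at h3
    linarith
  have hN0 : (0 : ℝ) ≤ N := Nat.cast_nonneg _
  obtain ⟨G, hG, hGc⟩ := exists_finset_modEq M' hM' 1 (A := (N : ℝ) / 2) (B := N) (by positivity)
  have hGc' : (N : ℝ) / (4 * M') ≤ G.card := by
    refine le_trans ?_ hGc
    rw [div_sub_one hMr'.ne', div_le_div_iff₀ (by positivity) hMr']
    nlinarith
  choose H hH hHc using fun n : ℕ => exists_finset_modEq M hM (z * n) (A := β * n) (B := γ * n)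
    (by positivity)
  refine ⟨(G.sigma H).image fun s => (s.2, s.1), ?_, ?_⟩
  · intro x hx
    obtain ⟨s, hs, rfl⟩ := Finset.mem_image.1 hx
    obtain ⟨hs1, hs2⟩ := Finset.mem_sigma.1 hs
    obtain ⟨g1, g2, g3⟩ := hG _ hs1
    obtain ⟨h1, h2, h3⟩ := hH _ _ hs2
    refine ⟨?_, ?_, g3, h3, h1, h2⟩
    · rw [div_lt_iff₀ two_pos] at g1
      have : (N : ℝ) < 2 * s.1 := by linarith
      exact_mod_cast this
    · exact_mod_cast g2.le
  · rw [Finset.card_image_of_injective _ (by rintro ⟨a, b⟩ ⟨c, d⟩ h; simp_all), Finset.card_sigma]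
    push_cast
    have hlow (n) (hn : n ∈ G) : (γ - β) * N / (4 * M) ≤ (H n).card := by
      refine le_trans ?_ (hHc n)
      have h1 := (hG n hn).1
      rw [← sub_mul, div_sub_one hMr.ne', div_le_div_iff₀ (by positivity) hMr]
      have h2 : (γ - β) * (N / 2) ≤ (γ - β) * n := by gcongr
      nlinarith
    calc (γ - β) / M / (16 * M') * (N : ℝ) ^ 2
        = N / (4 * M') * ((γ - β) * N / (4 * M)) := by field_simp; ring
      _ ≤ G.card * ((γ - β) * N / (4 * M)) := by gcongr
      _ ≤ ∑ n ∈ G, ((H n).card : ℝ) := by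
        rw [← nsmul_eq_mul]
        exact Finset.card_nsmul_le_sum _ _ _ hlow

namespace Place

open Classical in
/-- The fractions `a / n` with `2 ^ k / 2 < n ≤ 2 ^ k`, with `a < n` and `gcd (a, n) ≤ D`, that are
integral at `v` and `w` and lie in `B`. -/
noncomputable def fractions (v w : Place) (B : Set v.Integers) (D k : ℕ) : Finset ℚ :=
  ((Finset.range (2 ^ k + 1) ×ˢ Finset.range (2 ^ k + 1)).filter fun x =>
    x.1 < x.2 ∧ 2 ^ k < 2 * x.2 ∧ x.2.Coprime v.modulus ∧ x.2.Coprime w.modulus ∧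
      v.ofRat ((x.1 : ℚ) / x.2) ∈ B ∧ x.1.gcd x.2 ≤ D).image fun x => (x.1 : ℚ) / x.2

theorem mem_fractions {v w : Place} {B : Set v.Integers} {D k : ℕ} {r : ℚ} :
    r ∈ fractions v w B D k ↔ ∃ a n : ℕ, a < n ∧ n ≤ 2 ^ k ∧ 2 ^ k < 2 * n ∧
      n.Coprime v.modulus ∧ n.Coprime w.modulus ∧ v.ofRat ((a : ℚ) / n) ∈ B ∧ a.gcd n ≤ D ∧
      r = (a : ℚ) / n := by
  simp only [fractions, Finset.mem_image, Finset.mem_filter, Finset.mem_product, Finset.mem_range,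
    Prod.exists]
  constructor
  · rintro ⟨a, n, ⟨⟨_, h2⟩, h3, h4, h5, h6, h7, h8⟩, rfl⟩
    exact ⟨a, n, h3, by lia, h4, h5, h6, h7, h8, rfl⟩
  · rintro ⟨a, n, h3, h2, h4, h5, h6, h7, h8, rfl⟩
    exact ⟨a, n, ⟨⟨by lia, by lia⟩, h3, h4, h5, h6, h7, h8⟩, rfl⟩

theorem natCast_div_gcd_eq (a n : ℕ) (hn : 0 < n) :
    (a : ℚ) / n = ((a / a.gcd n : ℕ) : ℚ) / (n / a.gcd n : ℕ) := by
  have hg : 0 < a.gcd n := Nat.gcd_pos_of_pos_right a hn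
  have hg' : ((a.gcd n : ℕ) : ℚ) ≠ 0 := by exact_mod_cast hg.ne'
  rw [Nat.cast_div (Nat.gcd_dvd_left a n) hg', Nat.cast_div (Nat.gcd_dvd_right a n) hg',
    div_div_div_cancel_right₀ hg']

theorem den_natCast_div (a n : ℕ) (hn : 0 < n) : ((a : ℚ) / n).den = n / a.gcd n := by
  have hg : 0 < a.gcd n := Nat.gcd_pos_of_pos_right a hn
  have hn' : 0 < n / a.gcd n := Nat.div_pos (Nat.gcd_le_right a hn) hg
  have hc := Nat.coprime_div_gcd_div_gcd hg
  rw [natCast_div_gcd_eq a n hn]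
  generalize a / a.gcd n = a' at hc ⊢
  generalize n / a.gcd n = n' at hc hn' ⊢
  have := Rat.den_div_eq_of_coprime (a := (a' : ℤ)) (b := (n' : ℤ))
    (by exact_mod_cast hn') (by simpa using hc)
  simp only [Int.cast_natCast] at this
  exact_mod_cast this

/-- The fraction determines its reduced form and the gcd the scaling, so each gcd accounts for at
most one pair per fraction. -/
theorem eq_of_gcd_eq_of_div_eq {s t : ℕ × ℕ} (hs : 0 < s.2) (ht : 0 < t.2)
    (hg : s.1.gcd s.2 = t.1.gcd t.2) (h : (s.1 : ℚ) / s.2 = (t.1 : ℚ) / t.2) : s = t := by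
  have h2 : s.2 = t.2 := by
    have hden := congrArg Rat.den h
    rw [den_natCast_div _ _ hs, den_natCast_div _ _ ht, hg] at hden
    rw [← Nat.div_mul_cancel (hg ▸ Nat.gcd_dvd_right s.1 s.2 : t.1.gcd t.2 ∣ s.2), hden,
      Nat.div_mul_cancel (Nat.gcd_dvd_right _ _)]
  rw [h2] at h
  have h0 : (t.2 : ℚ) ≠ 0 := by exact_mod_cast ht.ne'
  have h1 : (s.1 : ℚ) = t.1 := by rwa [div_left_inj' h0] at h
  exact Prod.ext (by exact_mod_cast h1) h2

/-- The bound `D` on the gcd makes reduced denominators grow with the level, so hits at infinitely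
many levels come from infinitely many rationals. -/
theorem two_pow_lt_of_mem_fractions {v w : Place} {B : Set v.Integers} {D k : ℕ} {r : ℚ}
    (h : r ∈ fractions v w B D k) : 2 ^ k < 2 * (D * r.den) := by
  obtain ⟨a, n, han, -, hk, -, -, -, hD, rfl⟩ := mem_fractions.1 h
  have hn : 0 < n := by lia
  rw [den_natCast_div a n hn]
  calc 2 ^ k < 2 * n := hk
    _ = 2 * (a.gcd n * (n / a.gcd n)) := by rw [Nat.mul_div_cancel' (Nat.gcd_dvd_right a n)]
    _ ≤ _ := by gcongr

theorem fractions_separated {v w : Place} {B : Set v.Integers} {D k : ℕ} {r s : ℚ}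
    (hr : r ∈ fractions v w B D k) (hs : s ∈ fractions v w B D k) (hne : r ≠ s) :
    ((4 : ℝ) ^ k)⁻¹ ≤ dist (w.ofRat r) (w.ofRat s) := by
  obtain ⟨a, n, han, hn, -, -, hnw, -, -, rfl⟩ := mem_fractions.1 hr
  obtain ⟨b, m, hbm, hm, -, -, hmw, -, -, rfl⟩ := mem_fractions.1 hs
  have := inv_sq_le_dist_ofRat han hbm hn hm hnw hmw hne
  push_cast at this
  rwa [← pow_mul, mul_comm k 2, pow_mul, show (2 : ℝ) ^ 2 = 4 by norm_num] at this

/-- The pairs with a given greatest common divisor give few points in a ball. -/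
theorem card_filter_gcd_le {w : Place} {c₁ c₂ : ℝ} (hμ : IsOneRegular w.haar c₁ c₂)
    {N : ℕ} {P : Finset (ℕ × ℕ)}
    (hP : ∀ x ∈ P, x.1 < x.2 ∧ x.2 ≤ N ∧ x.2.Coprime w.modulus) (x : w.Integers) {ρ : ℝ}
    (hρ : 0 < ρ) (hPx : ∀ y ∈ P, dist (w.ofRat ((y.1 : ℚ) / y.2)) x ≤ ρ) {d : ℕ} (hd : 0 < d)
    (hdN : d ≤ N) :
    ((P.filter fun y => y.1.gcd y.2 = d).card : ℝ) ≤
      3 * c₂ / c₁ * (ρ * N ^ 2 * ((d : ℝ) ^ 2)⁻¹ + 1) := by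
  have hc₁ := hμ.pos
  have hd' : (0 : ℝ) < d := by exact_mod_cast hd
  have hN' : (0 : ℝ) < N := by exact_mod_cast hd.trans_le hdN
  have hdN' : (d : ℝ) ≤ N := by exact_mod_cast hdN
  have hδ1 : ((d : ℝ) / N) ^ 2 ≤ 1 := pow_le_one₀ (by positivity) ((div_le_one hN').2 hdN')
  -- Cancelling `d` leaves denominators at most `N / d`, so these fractions are `(d / N) ^
  -- 2`-separated.
  have h := hμ.card_le (P.filter fun y => y.1.gcd y.2 = d)
    (fun y => w.ofRat ((y.1 : ℚ) / y.2)) (δ := ((d : ℝ) / N) ^ 2) (by positivity) hδ1 hρ.le x ?_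
    (fun y hy => hPx y (Finset.mem_filter.1 hy).1)
  · rw [← le_div_iff₀ (by positivity)] at h
    refine h.trans (le_of_eq ?_)
    field_simp
  · rintro ⟨a, n⟩ hy ⟨b, m⟩ hy' hne
    obtain ⟨hyP, hg⟩ := Finset.mem_filter.1 hy
    obtain ⟨hyP', hg'⟩ := Finset.mem_filter.1 hy'
    obtain ⟨han, hnN, hnw⟩ := hP _ hyP
    obtain ⟨hbm, hmN, hmw⟩ := hP _ hyP'
    dsimp only at *
    obtain ⟨a', rfl⟩ : d ∣ a := hg ▸ Nat.gcd_dvd_left a n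
    obtain ⟨n', rfl⟩ : d ∣ n := hg ▸ Nat.gcd_dvd_right _ n
    obtain ⟨b', rfl⟩ : d ∣ b := hg' ▸ Nat.gcd_dvd_left b m
    obtain ⟨m', rfl⟩ : d ∣ m := hg' ▸ Nat.gcd_dvd_right _ m
    have han' : a' < n' := lt_of_mul_lt_mul_left han (Nat.zero_le d)
    have hbm' : b' < m' := lt_of_mul_lt_mul_left hbm (Nat.zero_le d)
    have hnN' : n' ≤ N / d := (Nat.le_div_iff_mul_le hd).2 (by rw [mul_comm]; exact hnN)
    have hmN' : m' ≤ N / d := (Nat.le_div_iff_mul_le hd).2 (by rw [mul_comm]; exact hmN)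
    have hdq : (d : ℚ) ≠ 0 := by exact_mod_cast hd.ne'
    push_cast
    rw [mul_div_mul_left _ _ hdq, mul_div_mul_left _ _ hdq]
    refine le_trans ?_ (inv_sq_le_dist_ofRat han' hbm' hnN' hmN' hnw.coprime_mul_left
      hmw.coprime_mul_left ?_)
    · have h1 : 0 < N / d := Nat.div_pos hdN hd
      have h2 : (0 : ℝ) < (N / d : ℕ) := by exact_mod_cast h1
      have h3 : ((N / d : ℕ) : ℝ) ≤ (N : ℝ) / d := Nat.cast_div_le
      rw [← inv_pow]
      refine pow_le_pow_left₀ (by positivity) ?_ 2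
      rw [← inv_div]
      exact inv_anti₀ h2 h3
    · intro heq
      refine hne (eq_of_gcd_eq_of_div_eq (by dsimp only; lia) (by dsimp only; lia)
        (hg.trans hg'.symm) ?_)
      push_cast
      rwa [mul_div_mul_left _ _ hdq, mul_div_mul_left _ _ hdq]

end Place

end Counting

/-! ### The divergence and convergence cases. -/

section Main

namespace Place

theorem modulus_ne_one_or {v w : Place} (h : v ≠ w) : v.modulus ≠ 1 ∨ w.modulus ≠ 1 := by
  cases v with
  | finite p => exact Or.inl p.2.one_lt.ne'
  | infinite =>
    cases w with
    | finite q => exact Or.inr q.2.one_lt.ne'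
    | infinite => exact absurd rfl h

/-- Many pairs `(a, n)` give fractions that lie in a fixed ball of `ℤ_v` and in a given small ball of
`ℤ_w`. -/
theorem exists_finset_pairs_mem_balls {v w : Place} (hvw : v ≠ w) (y : v.Integers) {σ : ℝ}
    (hσ : 0 < σ) (hσ1 : σ < 1 / 2) : ∃ κ : ℝ, 0 < κ ∧ ∀ (x : w.Integers) (ρ : ℝ), 0 < ρ → ρ < 1 / 2 →
      ∃ N₀ : ℕ, ∀ N : ℕ, N₀ ≤ N → ∃ P : Finset (ℕ × ℕ),
        (∀ s ∈ P, s.1 < s.2 ∧ s.2 ≤ N ∧ N < 2 * s.2 ∧ s.2.Coprime v.modulus ∧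
          s.2.Coprime w.modulus ∧ dist (v.ofRat ((s.1 : ℚ) / s.2)) y ≤ σ ∧
          dist (w.ofRat ((s.1 : ℚ) / s.2)) x ≤ ρ) ∧ κ * ρ * (N : ℝ) ^ 2 ≤ P.card := by
  obtain ⟨_, _, hboxv⟩ := exists_box_subset_closedBall v
  obtain ⟨zv, ev, βv, γv, hβv, hβγv, hγv, hv1, -, hv⟩ := hboxv y σ hσ hσ1
  obtain ⟨c, hc, hboxw⟩ := exists_box_subset_closedBall w
  have hqv : (0 : ℝ) < v.modulus := by exact_mod_cast v.modulus_pos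
  have hqw : (0 : ℝ) < w.modulus := by exact_mod_cast w.modulus_pos
  have hl : 0 < γv - βv := by linarith
  refine ⟨(γv - βv) / (v.modulus : ℝ) ^ ev * c / (16 * (v.modulus * w.modulus : ℕ)), ?_, ?_⟩
  · push_cast
    positivity
  intro x ρ hρ hρ1
  obtain ⟨zw, ew, βw, γw, hβw, hβγw, hγw, hw1, hcw, hw⟩ := hboxw x ρ hρ hρ1
  have hcop : (v.modulus ^ ev).Coprime (w.modulus ^ ew) := (coprime_modulus hvw).pow _ _
  obtain ⟨z, hz1, hz2⟩ := Nat.chineseRemainder hcop zv zw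
  -- At most one place is infinite, so one of the intervals is `(0, 1)` and the intersection is the
  -- other one.
  obtain ⟨β, γ, hβ, hβγ, hβ1, hβ2, hγ1, hγ2, hlen⟩ : ∃ β γ : ℝ, 0 ≤ β ∧ β < γ ∧ βv ≤ β ∧ βw ≤ β ∧
      γ ≤ γv ∧ γ ≤ γw ∧ γ - β = (γv - βv) * (γw - βw) := by
    have : (βv = 0 ∧ γv = 1) ∨ (βw = 0 ∧ γw = 1) := by
      rcases modulus_ne_one_or hvw with h | h
      · exact Or.inl (hv1.resolve_left h)
      · exact Or.inr (hw1.resolve_left h)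
    rcases this with ⟨rfl, rfl⟩ | ⟨rfl, rfl⟩
    · exact ⟨βw, γw, hβw, hβγw, hβw, le_rfl, hγw, le_rfl, by ring⟩
    · exact ⟨βv, γv, hβv, hβγv, le_rfl, hβv, le_rfl, hγv, by ring⟩
  obtain ⟨N₀, hN₀⟩ := exists_finset_pairs (v.modulus ^ ev * w.modulus ^ ew)
    (v.modulus * w.modulus) (by have := v.modulus_pos; have := w.modulus_pos; positivity)
    (Nat.mul_pos v.modulus_pos w.modulus_pos) z hβ hβγ
  refine ⟨N₀, fun N hN => ?_⟩
  obtain ⟨P, hP, hPc⟩ := hN₀ N hN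
  refine ⟨P, fun s hs => ?_, le_trans ?_ hPc⟩
  · obtain ⟨h1, h2, h3, h4, h5, h6⟩ := hP s hs
    have hn0 : 0 < s.2 := by lia
    have hn0' : (0 : ℝ) < s.2 := by exact_mod_cast hn0
    have h3v : s.2 ≡ 1 [MOD v.modulus] := h3.of_mul_right _
    have h3w : s.2 ≡ 1 [MOD w.modulus] := h3.of_mul_left _
    refine ⟨?_, h2, h1, ?_, ?_, ?_, ?_⟩
    · have : (s.1 : ℝ) < s.2 := by nlinarith
      exact_mod_cast this
    · rw [Nat.Coprime, h3v.gcd_eq, Nat.gcd_one_left]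
    · rw [Nat.Coprime, h3w.gcd_eq, Nat.gcd_one_left]
    · refine hv _ _ hn0 h3v ((h4.of_mul_right _).trans (hz1.mul_right _)) ?_ ?_ <;> nlinarith
    · refine hw _ _ hn0 h3w ((h4.of_mul_left _).trans (hz2.mul_right _)) ?_ ?_ <;> nlinarith
  · refine mul_le_mul_of_nonneg_right ?_ (by positivity)
    rw [hlen]
    calc (γv - βv) / (v.modulus : ℝ) ^ ev * c / (16 * (v.modulus * w.modulus : ℕ)) * ρ
        = (γv - βv) / (v.modulus : ℝ) ^ ev * (c * ρ) / (16 * (v.modulus * w.modulus : ℕ)) := by ring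
      _ ≤ (γv - βv) / (v.modulus : ℝ) ^ ev * ((γw - βw) / (w.modulus : ℝ) ^ ew) /
          (16 * (v.modulus * w.modulus : ℕ)) := by gcongr
      _ = _ := by push_cast; field_simp

/-- Every small ball of `ℤ_w` contains a positive proportion of the fractions that are expected. -/
theorem exists_card_fractions_ge {v w : Place} (hvw : v ≠ w) {B : Set v.Integers}
    (hB : v.IsBall B) : ∃ (D : ℕ) (κ : ℝ), 0 < κ ∧ ∀ (x : w.Integers) (ρ : ℝ), 0 < ρ → ρ < 1 / 2 →
      ∃ k₀ : ℕ, ∀ k : ℕ, k₀ ≤ k → ∃ G ⊆ fractions v w B D k,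
        (∀ r ∈ G, dist (w.ofRat r) x ≤ ρ) ∧ κ * 4 ^ k * ρ ≤ G.card := by
  classical
  obtain ⟨y, σ, hσ, hσ1, hyB⟩ : ∃ (y : v.Integers) (σ : ℝ), 0 < σ ∧ σ < 1 / 2 ∧
      Metric.closedBall y σ ⊆ B := by
    obtain ⟨y, τ, hτ, h⟩ := hB
    refine ⟨y, min τ (1 / 2) / 2, by positivity, ?_, ?_⟩
    · linarith [min_le_right τ (1 / 2)]
    · have h1 : min τ (1 / 2) / 2 < τ := by
        have := min_le_left τ (1 / 2)
        linarith
      rcases h with rfl | rfl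
      · exact Metric.closedBall_subset_ball h1
      · exact Metric.closedBall_subset_closedBall h1.le
  obtain ⟨κ, hκ, hpairs⟩ := exists_finset_pairs_mem_balls hvw y hσ hσ1
  obtain ⟨c₁, c₂, hμ⟩ := exists_isOneRegular_haar w
  have hc₁ := hμ.pos
  have hc₂ : 0 < c₂ := hμ.upper_pos
  set C := 3 * c₂ / c₁ with hC
  have hCpos : 0 < C := by positivity
  -- As `∑ 1 / d ^ 2` over `d > D` is at most `1 / D`, this choice limits the main term for gcds
  -- above `D` to a quarter of the guaranteed pairs.
  set D : ℕ := ⌈4 * C / κ⌉₊ + 1 with hD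
  have hD0 : (0 : ℝ) < D := by rw [hD]; positivity
  have hDκ : C / D ≤ κ / 4 := by
    have h1 : 4 * C / κ ≤ D := by
      rw [hD]; push_cast
      linarith [Nat.le_ceil (4 * C / κ)]
    rw [div_le_iff₀ hκ] at h1
    rw [div_le_iff₀ hD0]
    linarith
  refine ⟨D, κ / (2 * D), by positivity, fun x ρ hρ hρ1 => ?_⟩
  obtain ⟨N₀, hN₀⟩ := hpairs x ρ hρ hρ1
  -- Since `k < 2 ^ k = N`, all three thresholds hold for `N`; the last makes the error `C * N` at
  -- most another quarter.
  refine ⟨N₀ + D + ⌈4 * C / (κ * ρ)⌉₊, fun k hk => ?_⟩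
  set N : ℕ := 2 ^ k with hN
  have hkN : k < N := Nat.lt_two_pow_self
  obtain ⟨P, hP, hPc⟩ := hN₀ N (by lia)
  have hDN : D ≤ N := by lia
  have hN0 : (0 : ℝ) < N := by rw [hN]; positivity
  have hNC : C * N ≤ κ * ρ * (N : ℝ) ^ 2 / 4 := by
    have h1 : 4 * C / (κ * ρ) ≤ N := by
      refine (Nat.le_ceil _).trans ?_
      exact_mod_cast (show ⌈4 * C / (κ * ρ)⌉₊ ≤ N by lia)
    rw [div_le_iff₀ (by positivity)] at h1
    nlinarith
  set G : Finset ℚ := (P.filter fun s => s.1.gcd s.2 ≤ D).image fun s => (s.1 : ℚ) / s.2 with hG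
  refine ⟨G, fun r hr => ?_, fun r hr => ?_, ?_⟩
  · obtain ⟨s, hs, rfl⟩ := Finset.mem_image.1 hr
    obtain ⟨hsP, hsD⟩ := Finset.mem_filter.1 hs
    obtain ⟨h1, h2, h3, h4, h5, h6, h7⟩ := hP s hsP
    exact mem_fractions.2 ⟨s.1, s.2, h1, h2, h3, h4, h5, hyB h6, hsD, rfl⟩
  · obtain ⟨s, hs, rfl⟩ := Finset.mem_image.1 hr
    exact (hP s (Finset.mem_filter.1 hs).1).2.2.2.2.2.2
  · have hsplit : (P.card : ℝ) = ∑ d ∈ Finset.Ioc 0 D, ((P.filter fun s => s.1.gcd s.2 = d).card : ℝ)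
        + ∑ d ∈ Finset.Ioc D N, ((P.filter fun s => s.1.gcd s.2 = d).card : ℝ) := by
      rw [Finset.sum_Ioc_consecutive _ (Nat.zero_le D) hDN, ← Nat.cast_sum,
        ← Finset.card_eq_sum_card_fiberwise]
      intro s hs
      obtain ⟨h1, h2, -⟩ := hP s hs
      have h3 : 0 < s.2 := by lia
      exact Finset.mem_coe.2 (Finset.mem_Ioc.2 ⟨Nat.gcd_pos_of_pos_right _ h3,
        (Nat.gcd_le_right _ h3).trans h2⟩)
    have hsmall : ∑ d ∈ Finset.Ioc 0 D, ((P.filter fun s => s.1.gcd s.2 = d).card : ℝ) ≤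
        D * G.card := by
      have h1 (d) (hd : d ∈ Finset.Ioc 0 D) :
          ((P.filter fun s => s.1.gcd s.2 = d).card : ℝ) ≤ G.card := by
        obtain ⟨hd0, hdD⟩ := Finset.mem_Ioc.1 hd
        refine Nat.cast_le.2 (Finset.card_le_card_of_injOn (fun s => (s.1 : ℚ) / s.2) ?_ ?_)
        · intro s hs
          obtain ⟨hsP, hsd⟩ := Finset.mem_filter.1 (Finset.mem_coe.1 hs)
          exact Finset.mem_coe.2 (Finset.mem_image_of_mem _
            (Finset.mem_filter.2 ⟨hsP, hsd.le.trans hdD⟩))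
        · intro s hs t ht hst
          obtain ⟨hsP, hsd⟩ := Finset.mem_filter.1 (Finset.mem_coe.1 hs)
          obtain ⟨htP, htd⟩ := Finset.mem_filter.1 (Finset.mem_coe.1 ht)
          have hs0 := (hP s hsP).1
          have ht0 := (hP t htP).1
          exact eq_of_gcd_eq_of_div_eq (by lia) (by lia) (hsd.trans htd.symm) hst
      calc _ ≤ ∑ d ∈ Finset.Ioc 0 D, (G.card : ℝ) := Finset.sum_le_sum h1
        _ = _ := by simp
    have hlarge : ∑ d ∈ Finset.Ioc D N, ((P.filter fun s => s.1.gcd s.2 = d).card : ℝ) ≤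
        C * (ρ * N ^ 2 * (D : ℝ)⁻¹) + C * N := by
      calc _ ≤ ∑ d ∈ Finset.Ioc D N, C * (ρ * N ^ 2 * ((d : ℝ) ^ 2)⁻¹ + 1) := by
            refine Finset.sum_le_sum fun d hd => ?_
            obtain ⟨hd0, hdN⟩ := Finset.mem_Ioc.1 hd
            refine card_filter_gcd_le hμ (fun s hs => ?_) x hρ (fun s hs => ?_) (by lia) hdN
            · obtain ⟨h1, h2, h3, h4, h5, h6, h7⟩ := hP s hs
              exact ⟨h1, h2, h5⟩
            · exact (hP s hs).2.2.2.2.2.2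
        _ = C * (ρ * N ^ 2 * ∑ d ∈ Finset.Ioc D N, ((d : ℝ) ^ 2)⁻¹) + C * (N - D : ℕ) := by
            rw [← Finset.mul_sum, Finset.sum_add_distrib, ← Finset.mul_sum, mul_add]
            simp
        _ ≤ _ := by
            have h1 := sum_Ioc_inv_sq_le_sub (α := ℝ) (k := D) (n := N) (by lia) hDN
            have h2 : (0 : ℝ) ≤ (N : ℝ)⁻¹ := by positivity
            have h3 : ∑ d ∈ Finset.Ioc D N, ((d : ℝ) ^ 2)⁻¹ ≤ (D : ℝ)⁻¹ := by linarith
            have h4 : ((N - D : ℕ) : ℝ) ≤ N := by exact_mod_cast Nat.sub_le N D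
            gcongr
    have h1 : C * (ρ * N ^ 2 * (D : ℝ)⁻¹) ≤ κ * ρ * (N : ℝ) ^ 2 / 4 := by
      calc C * (ρ * N ^ 2 * (D : ℝ)⁻¹) = C / D * (ρ * N ^ 2) := by ring
        _ ≤ κ / 4 * (ρ * N ^ 2) := by gcongr
        _ = _ := by ring
    have h2 : κ * ρ * (N : ℝ) ^ 2 / 2 ≤ D * G.card := by linarith
    have h3 : (N : ℝ) ^ 2 = 4 ^ k := by
      rw [hN]; push_cast
      rw [← pow_mul, mul_comm, pow_mul]; norm_num
    rw [h3] at h2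
    rw [div_mul_eq_mul_div, div_mul_eq_mul_div, div_le_iff₀ (by positivity)]
    linarith

/-- Cauchy condensation: the block from `2 ^ K` to `2 ^ (K + 1)` has `2 ^ K` terms, each at most `2
^ (K + 1) * ψ (2 ^ K)`. -/
theorem not_summable_condensed {ψ : ℝ → ℝ} (hpos : ∀ x : ℝ, 0 < x → 0 < ψ x)
    (hanti : AntitoneOn ψ (Set.Ioi 0)) (h : ¬ Summable fun n : ℕ => (n : ℝ) * ψ n) :
    ¬ Summable fun k : ℕ => (4 : ℝ) ^ k * ψ (2 ^ k) := by
  intro hs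
  apply h
  have hψ (n : ℕ) : 0 ≤ (n : ℝ) * ψ n := by
    rcases Nat.eq_zero_or_pos n with rfl | hn
    · simp
    · exact mul_nonneg n.cast_nonneg (hpos _ (by exact_mod_cast hn)).le
  have ht (k : ℕ) : 0 ≤ (4 : ℝ) ^ k * ψ (2 ^ k) :=
    mul_nonneg (by positivity) (hpos _ (by positivity)).le
  have hsum (K : ℕ) : ∑ n ∈ Finset.range (2 ^ K), (n : ℝ) * ψ n ≤
      ∑ k ∈ Finset.range K, 2 * ((4 : ℝ) ^ k * ψ (2 ^ k)) := by
    induction K with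
    | zero => simp
    | succ K ih =>
      rw [← Finset.sum_range_add_sum_Ico _ (Nat.pow_le_pow_right two_pos K.le_succ),
        Finset.sum_range_succ]
      refine add_le_add ih ?_
      have h1 (n : ℕ) (hn : n ∈ Finset.Ico (2 ^ K) (2 ^ (K + 1))) :
          (n : ℝ) * ψ n ≤ 2 ^ (K + 1) * ψ (2 ^ K) := by
        obtain ⟨hn1, hn2⟩ := Finset.mem_Ico.1 hn
        have hn1' : (2 : ℝ) ^ K ≤ n := by exact_mod_cast hn1
        have hn2' : (n : ℝ) ≤ 2 ^ (K + 1) := by exact_mod_cast hn2.le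
        have hK : (0 : ℝ) < 2 ^ K := by positivity
        have hn0 : (0 : ℝ) < n := hK.trans_le hn1'
        exact mul_le_mul hn2' (hanti hK hn0 hn1') (hpos _ hn0).le (by positivity)
      refine (Finset.sum_le_card_nsmul _ _ _ h1).trans (le_of_eq ?_)
      rw [Nat.card_Ico, pow_succ, mul_two, Nat.add_sub_cancel, nsmul_eq_mul]
      push_cast
      rw [show (4 : ℝ) = 2 * 2 by norm_num, mul_pow, pow_succ]
      ring
  refine summable_of_sum_range_le (c := ∑' k : ℕ, 2 * ((4 : ℝ) ^ k * ψ (2 ^ k))) hψ fun n => ?_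
  calc _ ≤ ∑ m ∈ Finset.range (2 ^ n), (m : ℝ) * ψ m :=
        Finset.sum_le_sum_of_subset_of_nonneg
          (Finset.range_mono Nat.lt_two_pow_self.le) fun m _ _ => hψ m
    _ ≤ _ := hsum n
    _ ≤ _ := (hs.mul_left 2).sum_le_tsum _ fun k _ => mul_nonneg zero_le_two (ht k)

theorem not_summable_min {t : ℕ → ℝ} (ht : ∀ k, 0 ≤ t k) (h : ¬ Summable t) {c : ℝ} (hc : 0 < c) :
    ¬ Summable fun k => min (t k) c := by
  intro hs
  apply h
  have h0 := hs.tendsto_atTop_zero.eventually_lt_const hc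
  refine Summable.of_norm_bounded_eventually_nat hs ?_
  filter_upwards [h0] with k hk
  rw [Real.norm_of_nonneg (ht k)]
  rcases min_lt_iff.1 hk with h1 | h1
  · rw [min_eq_left h1.le]
  · exact absurd h1 (lt_irrefl _)

theorem haar_singleton (w : Place) (x : w.Integers) : w.haar {x} = 0 := by
  obtain ⟨c₁, c₂, hμ⟩ := exists_isOneRegular_haar w
  have hc₂ : 0 < c₂ := hμ.upper_pos
  have h : w.haar.real {x} ≤ 0 := by
    refine le_of_forall_pos_le_add fun ε hε => ?_
    have h1 := hμ.upper x (ε / c₂) (by positivity)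
    have h2 : w.haar.real {x} ≤ w.haar.real (Metric.closedBall x (ε / c₂)) :=
      measureReal_mono (Set.singleton_subset_iff.2 (Metric.mem_closedBall_self (by positivity)))
    rw [mul_div_cancel₀ _ hc₂.ne'] at h1
    linarith
  have h' := le_antisymm h measureReal_nonneg
  rwa [measureReal_def, ENNReal.toReal_eq_zero_iff, or_iff_left (measure_ne_top _ _)] at h'

theorem haar_approximables_eq_one {v w : Place} (hvw : v ≠ w) {B : Set v.Integers}
    (hB : v.IsBall B) {ψ : ℝ → ℝ} (hpos : ∀ x : ℝ, 0 < x → 0 < ψ x)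
    (hanti : AntitoneOn ψ (Set.Ioi 0)) (h : ¬ Summable fun n : ℕ => (n : ℝ) * ψ n) :
    w.haar (approximables v w ψ B) = 1 := by
  obtain ⟨D, κ, hκ, hcard⟩ := exists_card_fractions_ge hvw hB
  obtain ⟨c₁, c₂, hμ⟩ := exists_isOneRegular_haar w
  set t : ℕ → ℝ := fun k => 4 ^ k * ψ (2 ^ k) with ht
  have hψ (k : ℕ) : 0 < ψ (2 ^ k) := hpos _ (by positivity)
  have ht0 (k) : 0 < t k := mul_pos (by positivity) (hψ k)
  -- Truncation at `1 / 4` keeps the balls of one level disjoint without losing divergence. The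
  -- factor `1 / 2` turns `dist ≤ r k` into the strict inequality `dist < 2 * r k`, where `2 * r k ≤
  -- ψ (2 ^ k)`.
  set r : ℕ → ℝ := fun k => min (t k) (1 / 4) / 2 / 4 ^ k with hr
  have hr0 (k) : 0 < r k := by
    have := ht0 k
    positivity
  have h4r (k) : 4 ^ k * r k = min (t k) (1 / 4) * (1 / 2) := by
    rw [hr]; field_simp
  have hae := hμ.ae_frequently_mem_closedBall (fractions v w B D) w.ofRat r hκ
    (fun k i hi j hj hij => fractions_separated hi hj hij) hcard hr0
    (fun k => by rw [h4r]; linarith [min_le_right (t k) (1 / 4)])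
    (by
      simp_rw [h4r]
      rw [summable_mul_right_iff (by norm_num)]
      exact not_summable_min (fun k => (ht0 k).le) (not_summable_condensed hpos hanti h)
        (by norm_num))
  have hne : ∀ᵐ α ∂w.haar, α ≠ 0 := by
    rw [ae_iff]
    simpa using haar_singleton w 0
  have hmem : ∀ᵐ α ∂w.haar, α ∈ approximables v w ψ B := by
    filter_upwards [hae, hne] with α hα hα0
    obtain ⟨δ₀, hδ₀, hδ⟩ := absSub_lt_of_dist_ofRat_lt hα0
    have hrlim : ∀ᶠ k : ℕ in Filter.atTop, 2 * r k ≤ δ₀ := by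
      have h1 : Filter.Tendsto (fun k : ℕ => ((4 : ℝ) ^ k)⁻¹) Filter.atTop (nhds 0) :=
        tendsto_inv_atTop_zero.comp (tendsto_pow_atTop_atTop_of_one_lt (by norm_num))
      filter_upwards [h1.eventually_le_const hδ₀] with k hk
      refine le_trans ?_ hk
      rw [inv_eq_one_div, le_div_iff₀ (by positivity)]
      linarith [h4r k, min_le_right (t k) (1 / 4)]
    -- Finitely many approximants would have denominators at most some `b`; a hit at a level `k ≥ 2
    -- * D * b` then gives `2 ^ k < 2 * D * b ≤ k`.
    intro hfin
    obtain ⟨b, hb⟩ := (hfin.image Rat.den).bddAbove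
    obtain ⟨k, ⟨s, hs, hsα⟩, hk, hkb⟩ := (hα.and_eventually
      (hrlim.and (Filter.eventually_ge_atTop (2 * (D * b))))).exists
    have hlt := two_pow_lt_of_mem_fractions hs
    have hden : s.den ≤ b := by
      refine hb (Set.mem_image_of_mem _ ?_)
      obtain ⟨a, n, han, hn, hkn, hnv, hnw, haB, -, rfl⟩ := mem_fractions.1 hs
      refine ⟨ratMem_of_ofRat_mem hnv haB, a, n, by lia, by push_cast; rfl, ?_⟩
      have hn0 : (0 : ℝ) < n := by exact_mod_cast (show 0 < n by lia)
      have hmax : max |((a : ℤ) : ℝ)| (n : ℝ) = n := by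
        rw [Int.cast_natCast, abs_of_nonneg a.cast_nonneg]
        exact max_eq_right (by exact_mod_cast han.le)
      have h2k : 2 * r k ≤ ψ (2 ^ k) := by
        have h1 := h4r k
        have h2 := min_le_left (t k) (1 / 4)
        have h3 : (4 : ℝ) ^ k * (2 * r k) ≤ 4 ^ k * ψ (2 ^ k) := by
          change _ ≤ t k
          linarith
        exact le_of_mul_le_mul_left h3 (by positivity)
      rw [hmax]
      refine (hδ a n (2 * r k) han hnw hk ?_).trans_le (h2k.trans ?_)
      · linarith [hr0 k]
      · refine hanti hn0 (by simp) ?_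
        exact_mod_cast hn
    have h1 : 2 * (D * s.den) ≤ 2 * (D * b) := by gcongr
    have h2 : k < 2 ^ k := Nat.lt_two_pow_self
    lia
  exact (measure_congr (Filter.eventuallyEq_univ.2 hmem)).trans measure_univ

/-- Pairs whose height is the denominator: each `n ≥ 1` has `2 * n + 1 ≤ 3 * n` numerators. -/
theorem summable_ite_natAbs_le {f : ℕ → ℝ} (h0 : ∀ n, 0 < n → 0 ≤ f n)
    (hf : Summable fun n : ℕ => (n : ℝ) * f n) :
    Summable fun x : ℕ × ℤ => if 0 < x.1 ∧ x.2.natAbs ≤ x.1 then f x.1 else 0 := by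
  have hfin (n : ℕ) (a : ℤ) (ha : a ∉ Finset.Icc (-n : ℤ) n) :
      (if 0 < n ∧ a.natAbs ≤ n then f n else 0) = 0 := by
    rw [Finset.mem_Icc] at ha
    exact if_neg (by lia)
  refine (summable_prod_of_nonneg ?_).2 ⟨fun n => ?_, ?_⟩
  · rintro ⟨n, a⟩
    dsimp only [Pi.zero_apply]
    split_ifs with h
    · exact h0 n h.1
    · exact le_rfl
  · exact summable_of_ne_finset_zero (s := Finset.Icc (-n : ℤ) n) (hfin n)
  · refine Summable.of_nonneg_of_le (fun n => ?_) (fun n => ?_) (hf.mul_left 3)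
    · refine tsum_nonneg fun a => ?_
      dsimp only
      split_ifs with h
      · exact h0 n h.1
      · exact le_rfl
    · dsimp only
      rw [tsum_eq_sum (hfin n)]
      rcases Nat.eq_zero_or_pos n with rfl | hn
      · simp
      · have hn1 : (1 : ℝ) ≤ n := by exact_mod_cast hn
        refine (Finset.sum_le_card_nsmul _ _ (f n) fun a _ => ?_).trans ?_
        · split_ifs
          · exact le_rfl
          · exact h0 n hn
        · rw [Int.card_Icc, nsmul_eq_mul, ← mul_assoc,
            show ((n : ℤ) + 1 - -n).toNat = 2 * n + 1 by lia]
          refine mul_le_mul_of_nonneg_right ?_ (h0 n hn)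
          push_cast
          linarith

/-- Pairs whose height is the numerator: each `a` has `|a|` denominators. The overlap `|a| = n` is
harmless for an upper bound. -/
theorem summable_ite_le_natAbs {f : ℕ → ℝ} (h0 : ∀ n, 0 < n → 0 ≤ f n)
    (hf : Summable fun n : ℕ => (n : ℝ) * f n) :
    Summable fun x : ℤ × ℕ => if 0 < x.2 ∧ x.2 ≤ x.1.natAbs then f x.1.natAbs else 0 := by
  have hfin (a : ℤ) (n : ℕ) (hn : n ∉ Finset.Icc 1 a.natAbs) :
      (if 0 < n ∧ n ≤ a.natAbs then f a.natAbs else 0) = 0 := by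
    rw [Finset.mem_Icc] at hn
    exact if_neg (by lia)
  refine (summable_prod_of_nonneg ?_).2 ⟨fun a => ?_, ?_⟩
  · rintro ⟨a, n⟩
    dsimp only [Pi.zero_apply]
    split_ifs with h
    · exact h0 _ (by lia)
    · exact le_rfl
  · exact summable_of_ne_finset_zero (s := Finset.Icc 1 a.natAbs) (hfin a)
  · have hsum (a : ℤ) : ∑' n : ℕ, (if 0 < n ∧ n ≤ a.natAbs then f a.natAbs else 0) =
        (a.natAbs : ℝ) * f a.natAbs := by
      rw [tsum_eq_sum (hfin a), Finset.sum_congr rfl (g := fun _ => f a.natAbs)]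
      · simp
      · intro n hn
        rw [Finset.mem_Icc] at hn
        exact if_pos (by lia)
    dsimp only
    simp_rw [hsum]
    refine Summable.of_nat_of_neg ?_ ?_
    · simpa using hf
    · simpa using hf

theorem haar_approximables_eq_zero {v w : Place} {B : Set v.Integers} {ψ : ℝ → ℝ}
    (hpos : ∀ x : ℝ, 0 < x → 0 < ψ x) (h : Summable fun n : ℕ => (n : ℝ) * ψ n) :
    w.haar (approximables v w ψ B) = 0 := by
  obtain ⟨c₁, c₂, hμ⟩ := exists_isOneRegular_haar w
  have hc₂ : 0 < c₂ := hμ.upper_pos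
  have hψ (n : ℕ) (hn : 0 < n) : 0 ≤ ψ n := (hpos _ (by exact_mod_cast hn)).le
  set g : ℤ × ℕ → ℝ := fun x => if 0 < x.2 then ψ (max |(x.1 : ℝ)| x.2) else 0 with hg
  have hg0 (x) : 0 ≤ g x := by
    simp only [hg]
    split_ifs with hx
    · exact (hpos _ (lt_max_of_lt_right (by exact_mod_cast hx))).le
    · exact le_rfl
  have hgsum : Summable g := by
    refine Summable.of_nonneg_of_le hg0 (fun x => ?_)
      (((Equiv.prodComm ℤ ℕ).summable_iff.2 (summable_ite_natAbs_le hψ h)).add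
        (summable_ite_le_natAbs hψ h))
    obtain ⟨a, n⟩ := x
    simp only [hg, Function.comp_apply, Equiv.prodComm_apply, Prod.swap_prod_mk]
    have habs : |(a : ℝ)| = (a.natAbs : ℝ) := by rw [Nat.cast_natAbs, Int.cast_abs]
    rw [habs]
    by_cases hn : 0 < n
    · have e1 : 0 ≤ if 0 < n ∧ a.natAbs ≤ n then ψ n else 0 := by
        split_ifs
        · exact hψ n hn
        · exact le_rfl
      have e2 : 0 ≤ if 0 < n ∧ n ≤ a.natAbs then ψ a.natAbs else 0 := by
        split_ifs with hna
        · exact hψ _ (hn.trans_le hna.2)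
        · exact le_rfl
      rw [if_pos hn]
      rcases le_total a.natAbs n with hle | hle
      · have hle' : (a.natAbs : ℝ) ≤ n := by exact_mod_cast hle
        rw [max_eq_right hle']
        exact (if_pos ⟨hn, hle⟩).symm.le.trans (le_add_of_nonneg_right e2)
      · have hle' : (n : ℝ) ≤ a.natAbs := by exact_mod_cast hle
        rw [max_eq_left hle']
        exact (if_pos ⟨hn, hle⟩).symm.le.trans (le_add_of_nonneg_left e1)
    · simp [hn]
  set s : ℤ × ℕ → Set w.Integers := fun x =>
    {α | 0 < x.2 ∧ w.absSub α ((x.1 : ℚ) / x.2) < ψ (max |(x.1 : ℝ)| x.2)} with hs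
  have hμs (x) : w.haar (s x) ≤ ENNReal.ofReal (2 * c₂ * g x) := by
    rcases (s x).eq_empty_or_nonempty with he | ⟨α, hα⟩
    · rw [he, measure_empty]
      exact zero_le
    · have hgx : g x = ψ (max |(x.1 : ℝ)| x.2) := if_pos hα.1
      have hgpos : 0 < g x := hgx ▸ hpos _ (lt_max_of_lt_right (by exact_mod_cast hα.1))
      -- The fraction need not lie in `ℤ_w`, so the ball is centred at a point of the set itself, at
      -- the cost of doubling the radius.
      have hsub : s x ⊆ Metric.closedBall α (2 * g x) := fun β hβ => by
        have := dist_le_absSub_add_absSub β α ((x.1 : ℚ) / x.2)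
        rw [Metric.mem_closedBall, hgx]
        linarith [hα.2, hβ.2]
      refine (measure_mono hsub).trans ?_
      rw [← ofReal_measureReal]
      refine ENNReal.ofReal_le_ofReal ((hμ.upper α (2 * g x) (by positivity)).trans ?_)
      linarith
  have hfin : ∑' x, w.haar (s x) ≠ ⊤ := by
    refine ne_top_of_le_ne_top ?_ (ENNReal.tsum_le_tsum hμs)
    exact (hgsum.mul_left (2 * c₂)).tsum_ofReal_ne_top
  have hae := ae_finite_setOfPred_mem hfin
  refine measure_mono_null (fun α hα => ?_) (ae_iff.1 hae)
  intro hf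
  refine hα ((hf.image fun x : ℤ × ℕ => (x.1 : ℚ) / x.2).subset ?_)
  rintro r ⟨-, a, n, hn, rfl, hlt⟩
  exact ⟨(a, n), ⟨hn, hlt⟩, rfl⟩

end Place

end Main

theorem theorem1p2 (p₁ p₂ : Place) (hne : p₁ ≠ p₂)
    (B : Set p₁.Integers) (hB : p₁.IsBall B)
    (ψ : ℝ → ℝ) (hpos : ∀ x : ℝ, 0 < x → 0 < ψ x) (hanti : AntitoneOn ψ (Set.Ioi 0))
    (hreg : ∀ s : ℝ, 1 < s → ∃ c : ℝ, 0 < c ∧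
      ∀ᶠ n : ℕ in Filter.atTop, c * ψ (n : ℝ) < ψ (s * (n : ℝ))) :
    (¬ Summable (fun n : ℕ => (n : ℝ) * ψ (n : ℝ)) →
      p₂.haar (Place.approximables p₁ p₂ ψ B) = 1) ∧
    (Summable (fun n : ℕ => (n : ℝ) * ψ (n : ℝ)) →
      p₂.haar (Place.approximables p₁ p₂ ψ B) = 0) :=
  ⟨Place.haar_approximables_eq_one hne hB hpos hanti, Place.haar_approximables_eq_zero hpos⟩
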